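/- Let $G=(V,E)$ be a finite undirected graph (parallel edges and loops allowed) and let $T\subseteq V$. A $T$-path is a path $P$ in $G$ (with two distinct endpoints, considered without direction) such that $V(P)\cap T$ consists of exactly the two endpoints of $P$. Let $J_{\rm vertex}(G,T)\subseteq\mathbb{Z}^T$ (respectively $J_{\rm edge}(G,T)\subseteq\mathbb{Z}^T$) be the set of all integer vectors $m$ for which there is a set $\mathcal{P}$ of $T$-paths, any two distinct members $P,Q$ of which are openly disjoint, i.e. satisfy $V(P)\cap V(Q)\subseteq T$ (respectively are edge-disjoint, i.e. satisfy $E(P)\cap E(Q)=\emptyset$), such that each $t\in T$ is an endpoint of exactly $m(t)$ members of $\mathcal{P}$. Then each of the convex hulls ${\rm conv}(J_{\rm vertex}(G,T))$ and ${\rm conv}(J_{\rm edge}(G,T))$ in $\mathbb{R}^T$ is a bisubmodular polyhedron, that is, it is of the form $$Q(b)=\{x\in\mathbb{R}^T : x\ge 0,\ x(A)-x(B)\le b(A,B)\text{ for all disjoint } A,B\subseteq T\},$$ where $x(A)=\sum_{t\in A}x_t$ and $b$ is a function on the pairs of disjoint subsets of $T$, with values in $\mathbb{N}=\{0,1,2,\dots\}$,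 satisfying for all pairs $(A,B)$ and $(A',B')$ of disjoint subsets of $T$ $$b(A,B)+b(A',B')\ge b(A\cap A',B\cap B')+b\big((A\cup A')\setminus(B\cup B'),(B\cup B')\setminus(A\cup A')\big).$$ -/

import Mathlib

open scoped Graph

namespace TPaths

/-- `Traverses G s t vs es`: going from `s` to `t` in the multigraph `G` (parallel edges and loops
are allowed) one meets the vertices `vs`, in this order and without repetition, and uses the
edges `es`, in this order. -/
inductive Traverses {α β : Type*} (G : Graph α β) : α → α → List α → List β → Prop
  | nil {x : α} (hx : x ∈ V(G)) : Traverses G x x [x] []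
  | cons {x y z : α} {e : β} {vs : List α} {es : List β} (he : G.IsLink e x y)
      (hp : Traverses G y z vs es) (hx : x ∉ vs) : Traverses G x z (x :: vs) (e :: es)

/-- The graph `P` is a path with endpoints `s` and `t`. As a graph, a path has no direction. -/
def IsPathBetween {α β : Type*} (P : Graph α β) (s t : α) : Prop :=
  ∃ (vs : List α) (es : List β), Traverses P s t vs es ∧
    V(P) = {v | v ∈ vs} ∧ E(P) = {e | e ∈ es}

/-- `P` is a `T`-path of `G`: a path in `G` whose two (distinct) endpoints are exactly its
vertices in `T`. -/
def IsTPath {α β : Type*} (G : Graph α β) (T : Set α) (P : Graph α β) : Prop :=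
  P ≤ G ∧ ∃ s t : α, s ≠ t ∧ IsPathBetween P s t ∧ V(P) ∩ T = {s, t}

/-- Every `t ∈ T` is an endpoint of exactly `m t` members of `F`. -/
def Realizes {α β : Type*} {T : Finset α} (F : Finset (Graph α β)) (m : T → ℤ) : Prop :=
  ∀ t : T, m t = ({P | P ∈ F ∧ ∃ s : α, IsPathBetween P t s} : Set (Graph α β)).ncard

/-- The set of vertex-feasible vectors: those realized by a set of openly disjoint `T`-paths. -/
def JVertex {α β : Type*} (G : Graph α β) (T : Finset α) : Set (T → ℤ) :=
  {m | ∃ F : Finset (Graph α β), (∀ P ∈ F, IsTPath G T P) ∧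
    (∀ P ∈ F, ∀ Q ∈ F, P ≠ Q → V(P) ∩ V(Q) ⊆ (T : Set α)) ∧ Realizes F m}

/-- The set of edge-feasible vectors: those realized by a set of edge-disjoint `T`-paths. -/
def JEdge {α β : Type*} (G : Graph α β) (T : Finset α) : Set (T → ℤ) :=
  {m | ∃ F : Finset (Graph α β), (∀ P ∈ F, IsTPath G T P) ∧
    (∀ P ∈ F, ∀ Q ∈ F, P ≠ Q → E(P) ∩ E(Q) = ∅) ∧ Realizes F m}

/-- The convex hull in `ℝ^ι` of a set of integer vectors. -/
def conv {ι : Type*} (J : Set (ι → ℤ)) : Set (ι → ℝ) :=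
  convexHull ℝ ((fun (m : ι → ℤ) (i : ι) => (m i : ℝ)) '' J)

/-- Bisubmodularity of a function on pairs of disjoint subsets of `ι`
(the values at other pairs are irrelevant). -/
def IsBisubmodular {ι : Type*} [DecidableEq ι] (b : Finset ι → Finset ι → ℕ) : Prop :=
  ∀ A B A' B' : Finset ι, Disjoint A B → Disjoint A' B' →
    b (A ∩ A') (B ∩ B') + b ((A ∪ A') \ (B ∪ B')) ((B ∪ B') \ (A ∪ A')) ≤ b A B + b A' B'

/-- The polyhedron `Q(b)` of the nonnegative vectors `x` with `x(A) - x(B) ≤ b(A,B)` for all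
disjoint `A`, `B`. -/
def bisubPolyhedron {ι : Type*} (b : Finset ι → Finset ι → ℕ) : Set (ι → ℝ) :=
  {x | (∀ i, 0 ≤ x i) ∧
    ∀ A B : Finset ι, Disjoint A B → ∑ i ∈ A, x i - ∑ i ∈ B, x i ≤ (b A B : ℝ)}

/-- A bisubmodular polyhedron is a set `Q(b)` with `b` bisubmodular and valued in `ℕ`. -/
def IsBisubmodularPolyhedron {ι : Type*} [DecidableEq ι] (S : Set (ι → ℝ)) : Prop :=
  ∃ b : Finset ι → Finset ι → ℕ, IsBisubmodular b ∧ S = bisubPolyhedron b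

end TPaths

/-! Both sets of vectors are jump systems of constant parity: after any unit step from a member m
towards a member n, some further unit step towards n leads back into the set. Convex hulls of such
sets behave well. If the coefficients of largest absolute value of a linear function w carry the
sign vector s, then w and s have a common maximizer (`exists_common_max`): an exchange that starts
with a gain in s gains the most possible in w, so its second step cannot lose more. Hence b(A,B) =
max (m(A) - m(B)) is bisubmodular. Peeling w into a nonnegative combination of sign vectors shows
that w is bounded on Q(b) by its maximum over the set, and separation gives Q(b) = conv.

The exchange property is proved for openly disjoint paths under a symmetric adjacency relation in
which no two terminals are adjacent. Let i have smaller degree in the packing P than in Q. Some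
member Z of Q leaves i by an edge that P does not use. Follow Z to its first inner vertex on a
member R of P and let this piece of Z replace one half of R; if there is no such vertex, add all of
Z. The change of degree at the other affected terminal is either the desired second step or an
overshoot to be corrected recursively. The recursion ends because the number of edges of P outside Q
drops (`canStep_pos`, `canStep_neg`).

Openly disjoint packings in G reduce to this by subdividing every edge, edge-disjoint ones by a line
graph with the terminals attached. Such an encoding need not be a bijection: it suffices that
translating a path, either way, keeps its ends and acquires no new non-terminals
(`setOf_realizes_eq`). -/

namespace TPaths

/-! ### Convex hulls of jump systems of constant parity -/

section Polyhedron

variable {ι : Type*}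

/-- The two-step axiom for jump systems of constant parity: the second step is always needed. -/
def IsParityJumpSystem [DecidableEq ι] (J : Set (ι → ℤ)) : Prop :=
  ∀ m ∈ J, ∀ n ∈ J, ∀ (i : ι) (ε : ℤ), (ε = 1 ∨ ε = -1) → 0 < ε * (n i - m i) →
    ∃ (j : ι) (δ : ℤ), (δ = 1 ∨ δ = -1) ∧ 0 < δ * (n j - (m + Pi.single i ε : ι → ℤ) j) ∧
      m + Pi.single i ε + Pi.single j δ ∈ J

variable [Fintype ι]

/-- The pairing of a real weight vector with a real vector. -/
def pairing (w x : ι → ℝ) : ℝ := ∑ i, w i * x i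

/-- The real vector underlying an integer vector. -/
def toReal (m : ι → ℤ) : ι → ℝ := fun i => (m i : ℝ)

lemma exists_max_pairing {J : Set (ι → ℤ)} (hJ : J.Finite) (h0 : J.Nonempty) (w : ι → ℝ) :
    ∃ n ∈ J, ∀ m ∈ J, pairing w (toReal m) ≤ pairing w (toReal n) :=
  Set.exists_max_image J (fun m => pairing w (toReal m)) hJ h0

lemma pairing_add (w x y : ι → ℝ) : pairing w (x + y) = pairing w x + pairing w y := by
  simp [pairing, mul_add, Finset.sum_add_distrib]

lemma pairing_smul (w x : ι → ℝ) (a : ℝ) : pairing w (a • x) = a * pairing w x := by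
  simp [pairing, Finset.mul_sum]; exact Finset.sum_congr rfl fun _ _ => by ring

variable [DecidableEq ι]

lemma pairing_add_single (w : ι → ℝ) (m : ι → ℤ) (i : ι) (ε : ℤ) :
    pairing w (toReal (m + Pi.single i ε)) = pairing w (toReal m) + w i * ε := by
  simp only [pairing, toReal, Pi.add_apply, Int.cast_add, mul_add, Finset.sum_add_distrib]
  congr 1
  rw [Finset.sum_eq_single i]
  · simp
  · intro b _ hb; simp [Pi.single_eq_of_ne hb]
  · simp

/-- The `ℓ₁` distance of two integer vectors. -/
def dist1 (m n : ι → ℤ) : ℕ := ∑ i, (m i - n i).natAbs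

lemma dist1_add_single_lt (m n : ι → ℤ) (i : ι) (ε : ℤ) (hε : ε = 1 ∨ ε = -1)
    (h : 0 < ε * (m i - n i)) : dist1 m (n + Pi.single i ε) < dist1 m n := by
  unfold dist1
  apply Finset.sum_lt_sum
  · intro j _
    by_cases hj : j = i
    · subst hj; simp only [Pi.add_apply, Pi.single_eq_same]; rcases hε with rfl | rfl <;> omega
    · simp [Pi.single_eq_of_ne hj]
  · refine ⟨i, Finset.mem_univ _, ?_⟩
    simp only [Pi.add_apply, Pi.single_eq_same]; rcases hε with rfl | rfl <;> omega

/-- If `s` is the sign vector of the coordinates where `|w|` takes its largest value `c`, then `w`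
and `s` have a common maximizer over a jump system. -/
lemma exists_common_max {J : Set (ι → ℤ)} (hJ : J.Finite) (h0 : J.Nonempty)
    (hjump : IsParityJumpSystem J) (w : ι → ℝ) (s : ι → ℤ) (c : ℝ)
    (hw : ∀ i, |w i| ≤ c) (hs : ∀ i, s i = 0 ∨ ((s i = 1 ∨ s i = -1) ∧ w i = c * s i)) :
    ∃ n ∈ J, (∀ m ∈ J, pairing w (toReal m) ≤ pairing w (toReal n)) ∧
      ∀ m ∈ J, pairing (toReal s) (toReal m) ≤ pairing (toReal s) (toReal n) := by
  obtain ⟨m, hm, hmax⟩ := exists_max_pairing hJ h0 (toReal s)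
  set N : Set (ι → ℤ) := {n | n ∈ J ∧ ∀ m ∈ J, pairing w (toReal m) ≤ pairing w (toReal n)}
  have hN : N.Finite := hJ.subset fun n hn => hn.1
  have hN0 : N.Nonempty := by
    obtain ⟨n, hn, h⟩ := exists_max_pairing hJ h0 w
    exact ⟨n, hn, h⟩
  -- Extremal choice: among the maximizers of `w`, take one nearest to the maximizer `m` of `s`. If
  -- it did not maximize `s`, an exchange towards `m` would give a nearer maximizer of `w`.
  obtain ⟨n, ⟨hn, hnw⟩, hmin⟩ := Set.exists_min_image N (dist1 m) hN hN0
  refine ⟨n, hn, hnw, fun m' hm' => (hmax m' hm').trans ?_⟩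
  by_contra hlt
  push Not at hlt
  obtain ⟨i, -, hi⟩ := Finset.exists_lt_of_sum_lt hlt
  have hi' : s i * n i < s i * m i := by
    simp only [toReal] at hi; exact_mod_cast hi
  rcases hs i with h | ⟨h, hwi⟩
  · simp [h] at hi'
  -- The first step raises `w` by exactly `c`; the second lowers it by at most `c`, since `|w j| ≤
  -- c`. The result is again a maximizer of `w`.
  obtain ⟨j, δ, hδ, hj, hmem⟩ := hjump n hn m hm i (s i) h (by linarith)
  have hval := hnw _ hmem
  rw [pairing_add_single, pairing_add_single] at hval
  have hsq : (s i : ℝ) * s i = 1 := by rcases h with h | h <;> simp [h]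
  have hstep : w i * s i = c := by rw [hwi, mul_assoc, hsq, mul_one]
  have hge : -c ≤ w j * δ := by
    have := abs_le.1 (hw j)
    rcases hδ with rfl | rfl <;> push_cast <;> linarith
  refine absurd (hmin _ ⟨hmem, fun m' hm' => ?_⟩) (not_le.2 ?_)
  · rw [pairing_add_single, pairing_add_single]
    linarith [hnw m' hm']
  · exact (dist1_add_single_lt m _ j δ hδ hj).trans
      (dist1_add_single_lt m n i (s i) h (by linarith))

lemma pairing_sign {A B : Finset ι} (hAB : Disjoint A B) (x : ι → ℝ) :
    pairing (toReal fun i => if i ∈ A then 1 else if i ∈ B then -1 else 0) x =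
      ∑ i ∈ A, x i - ∑ i ∈ B, x i := by
  have h : ∀ i, toReal (fun i => if i ∈ A then 1 else if i ∈ B then -1 else 0) i * x i =
      (if i ∈ A then x i else 0) - (if i ∈ B then x i else 0) := by
    intro i
    by_cases hA : i ∈ A
    · simp [toReal, hA, Finset.disjoint_left.1 hAB hA]
    · by_cases hB : i ∈ B <;> simp [toReal, hA, hB]
  simp [pairing, h, Finset.sum_sub_distrib]

/-- Linear functions are bounded on the polyhedron by their maxima over the jump system. -/
lemma exists_max_of_polyhedron {J : Set (ι → ℤ)} (hJ : J.Finite) (h0 : J.Nonempty)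
    (hjump : IsParityJumpSystem J) {x : ι → ℝ}
    (hx : ∀ A B : Finset ι, Disjoint A B → ∃ m ∈ J,
      ∑ i ∈ A, x i - ∑ i ∈ B, x i ≤ ∑ i ∈ A, toReal m i - ∑ i ∈ B, toReal m i)
    (w : ι → ℝ) : ∃ n ∈ J, pairing w x ≤ pairing w (toReal n) := by
  classical
  -- Induction on the number of distinct values of `|w|`, with 0 always counted. The top value `c`
  -- is merged into the next one, `d`.
  induction hk : (insert 0 (Finset.univ.image fun i => |w i|)).card using Nat.strong_induction_on
    generalizing w with
  | _ k ih =>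
  set I := insert 0 (Finset.univ.image fun i => |w i|) with hI
  have hIne : I.Nonempty := ⟨0, by simp [hI]⟩
  set c := I.max' hIne
  have hcw : ∀ i, |w i| ≤ c := fun i => Finset.le_max' _ _ (by simp [hI])
  have hc0 : 0 ≤ c := Finset.le_max' _ _ (by simp [hI])
  rcases hc0.eq_or_lt with hc0 | hc0
  · obtain ⟨n, hn⟩ := h0
    have : ∀ i, w i = 0 := fun i => abs_eq_zero.1 (le_antisymm (hc0 ▸ hcw i) (abs_nonneg _))
    exact ⟨n, hn, by simp [pairing, this]⟩
  have hne : (I.erase c).Nonempty := ⟨0, by simp [hI, hc0.ne]⟩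
  set d := (I.erase c).max' hne
  have hdI : d ∈ I.erase c := Finset.max'_mem _ _
  have hd0 : 0 ≤ d := Finset.le_max' _ _ (by simp [hI, hc0.ne])
  have hdc : d ≤ c := Finset.le_max' _ _ (Finset.mem_of_mem_erase hdI)
  have hdw : ∀ i, |w i| ≠ c → |w i| ≤ d := fun i hi =>
    Finset.le_max' _ _ (Finset.mem_erase.2 ⟨hi, by simp [hI]⟩)
  set A := Finset.univ.filter fun i => w i = c with hA
  set B := Finset.univ.filter fun i => w i = -c with hB
  have hAB : Disjoint A B := by
    rw [Finset.disjoint_left]; intro i hiA hiB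
    simp only [hA, hB, Finset.mem_filter_univ] at hiA hiB
    linarith
  set s : ι → ℤ := fun i => if i ∈ A then 1 else if i ∈ B then -1 else 0 with hs
  have hcase : ∀ i, (w i = c ∧ s i = 1) ∨ (w i = -c ∧ s i = -1) ∨ (|w i| ≠ c ∧ s i = 0) := by
    intro i
    by_cases h1 : w i = c
    · exact Or.inl ⟨h1, by simp [hs, hA, h1]⟩
    by_cases h2 : w i = -c
    · exact Or.inr (Or.inl ⟨h2, by 
      have h3 : -c ≠ c := by rwa [← h2]
      simp [hs, hA, hB, h2, h3]⟩)
    · refine Or.inr (Or.inr ⟨fun h => ?_, by simp [hs, hA, hB, h1, h2]⟩)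
      rcases abs_eq hc0.le |>.1 h with h | h <;> contradiction
  -- Here `w = w' + (c - d) s` with `c - d ≥ 0`, and `w'` equals `d s` on the support of `s`, with
  -- `|w'| ≤ d` everywhere. So `w'` and `s` have a common maximizer, at which the two bounds add up.
  set w' : ι → ℝ := fun i => w i - (c - d) * s i with hw'
  have hw'd : ∀ i, |w' i| ∈ I.erase c ∧ |w' i| ≤ d ∧
      (s i = 0 ∨ ((s i = 1 ∨ s i = -1) ∧ w' i = d * s i)) := by
    intro i
    rcases hcase i with ⟨h1, h2⟩ | ⟨h1, h2⟩ | ⟨h1, h2⟩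
    · have : w' i = d := by simp [hw', h1, h2]
      simp [this, h2, abs_of_nonneg hd0, hdI]
    · have : w' i = -d := by simp only [hw', h1, h2]; push_cast; ring
      simp [this, h2, abs_of_nonneg hd0, hdI]
    · have : w' i = w i := by simp [hw', h2]
      rw [this]
      exact ⟨Finset.mem_erase.2 ⟨h1, by simp [hI]⟩, hdw i h1, Or.inl h2⟩
  have hcard : (insert 0 (Finset.univ.image fun i => |w' i|)).card < k := by
    rw [← hk]
    refine (Finset.card_le_card ?_).trans_lt (Finset.card_erase_lt_of_mem (I.max'_mem hIne))
    intro a ha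
    simp only [Finset.mem_insert, Finset.mem_image, Finset.mem_univ, true_and] at ha
    rcases ha with rfl | ⟨i, rfl⟩
    · exact Finset.mem_erase.2 ⟨hc0.ne, by simp [hI]⟩
    · exact (hw'd i).1
  obtain ⟨n₀, hn₀, hxn₀⟩ := ih _ hcard w' rfl
  obtain ⟨n, hn, hmaxw, hmaxs⟩ := exists_common_max hJ h0 hjump w' s d (fun i => (hw'd i).2.1)
    (fun i => (hw'd i).2.2)
  have hdec : ∀ y, pairing w y = pairing w' y + (c - d) * pairing (toReal s) y := by
    intro y
    simp only [pairing, Finset.mul_sum, ← Finset.sum_add_distrib, hw', toReal]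
    exact Finset.sum_congr rfl fun _ _ => by ring
  refine ⟨n, hn, ?_⟩
  obtain ⟨m, hm, hxm⟩ := hx A B hAB
  rw [← pairing_sign hAB, ← pairing_sign hAB] at hxm
  rw [hdec, hdec]
  have h1 := hxn₀.trans (hmaxw _ hn₀)
  have h2 : (c - d) * pairing (toReal s) x ≤ (c - d) * pairing (toReal s) (toReal n) :=
    mul_le_mul_of_nonneg_left (hxm.trans (hmaxs m hm)) (by linarith)
  linarith

/-- A point at which every linear function is at most its maximum over a finite set of integer
vectors lies in the convex hull of the set. -/
lemma mem_conv_of_forall_pairing {J : Set (ι → ℤ)} (hJ : J.Finite) {x : ι → ℝ}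
    (hx : ∀ w : ι → ℝ, ∃ n ∈ J, pairing w x ≤ pairing w (toReal n)) : x ∈ conv J := by
  by_contra hmem
  obtain ⟨f, u, hfu, hux⟩ := geometric_hahn_banach_closed_point (convex_convexHull ℝ _)
    ((hJ.image _).isClosed_convexHull ℝ) hmem
  have hf : ∀ y, f y = pairing (fun i => f (Pi.single i 1)) y := by
    intro y
    conv_lhs => rw [← Finset.univ_sum_single y, map_sum]
    refine Finset.sum_congr rfl fun i _ => ?_
    have : (Pi.single i (y i) : ι → ℝ) = y i • Pi.single i 1 := by
      rw [← Pi.single_smul]; simp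
    rw [this, map_smul, smul_eq_mul, mul_comm]
  obtain ⟨n, hn, hle⟩ := hx fun i => f (Pi.single i 1)
  rw [← hf, ← hf] at hle
  have := hfu _ (subset_convexHull ℝ _ ⟨n, hn, rfl⟩)
  exact absurd (hle.trans_lt this) (not_lt.2 hux.le)

/-- The convex hull of a finite nonnegative jump system of constant parity that contains `0` is a
bisubmodular polyhedron. -/
theorem IsParityJumpSystem.isBisubmodularPolyhedron {J : Set (ι → ℤ)} (hJ : J.Finite)
    (h0 : 0 ∈ J) (hnonneg : ∀ m ∈ J, ∀ i, 0 ≤ m i) (hjump : IsParityJumpSystem J) :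
    IsBisubmodularPolyhedron (conv J) := by
  have hne : J.Nonempty := ⟨0, h0⟩
  -- The maximum is a natural number because the zero vector belongs to `J`.
  have hmax : ∀ A B : Finset ι, ∃ k : ℕ, (∃ n ∈ J, (k : ℤ) = ∑ i ∈ A, n i - ∑ i ∈ B, n i) ∧
      ∀ m ∈ J, ∑ i ∈ A, m i - ∑ i ∈ B, m i ≤ (k : ℤ) := by
    intro A B
    obtain ⟨n, hn, hmax⟩ :=
      Set.exists_max_image J (fun m => ∑ i ∈ A, m i - ∑ i ∈ B, m i) hJ hne
    have := hmax 0 h0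
    simp only [Pi.zero_apply, Finset.sum_const_zero, sub_zero] at this
    obtain ⟨k, hk⟩ := Int.eq_ofNat_of_zero_le this
    exact ⟨k, ⟨n, hn, hk.symm⟩, fun m hm => hk ▸ hmax m hm⟩
  choose b hb hbmax using hmax
  refine ⟨b, ?_, ?_⟩
  · intro A B A' B' hAB hAB'
    set K := (A ∪ A') \ (B ∪ B') with hK
    set L := (B ∪ B') \ (A ∪ A') with hL
    have hCD : Disjoint (A ∩ A') (B ∩ B') :=
      hAB.mono Finset.inter_subset_left Finset.inter_subset_left
    have hKL : Disjoint K L := by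
      rw [Finset.disjoint_left]; intro i; simp only [hK, hL, Finset.mem_sdiff]; tauto
    have hdisj : ∀ i, i ∈ A → i ∉ B := fun i h => Finset.disjoint_left.1 hAB h
    have hdisj' : ∀ i, i ∈ A' → i ∉ B' := fun i h => Finset.disjoint_left.1 hAB' h
    -- The sign vectors of (A,B) and (A',B') have the same sum as those of (A∩A', B∩B') and (K,L).
    -- Where the intersection vector is nonzero, the vector of (K,L) agrees with it, so with `c = 1`
    -- a single `n` attains both maxima on the smaller side of the inequality.
    obtain ⟨n, hn, h1, h2⟩ := exists_common_max hJ hne hjump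
      (toReal fun i => if i ∈ K then 1 else if i ∈ L then -1 else 0)
      (fun i => if i ∈ A ∩ A' then 1 else if i ∈ B ∩ B' then -1 else 0) 1
      (fun i => by unfold toReal; beta_reduce; split_ifs <;> simp)
      (fun i => by
        have := hdisj i
        have := hdisj' i
        simp only [toReal, hK, hL, Finset.mem_sdiff, Finset.mem_union, Finset.mem_inter]
        by_cases i ∈ A <;> by_cases i ∈ A' <;> by_cases i ∈ B <;> by_cases i ∈ B' <;> simp_all)
    simp only [pairing_sign hKL] at h1
    simp only [pairing_sign hCD] at h2
    obtain ⟨p, hp, hbp⟩ := hb (A ∩ A') (B ∩ B')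
    obtain ⟨q, hq, hbq⟩ := hb K L
    have e1 := h1 q hq
    have e2 := h2 p hp
    have f1 := hbmax A B n hn
    have f2 := hbmax A' B' n hn
    simp only [toReal] at e1 e2
    have e1' : (b K L : ℤ) ≤ ∑ i ∈ K, n i - ∑ i ∈ L, n i := by rw [hbq]; exact_mod_cast e1
    have e2' : (b (A ∩ A') (B ∩ B') : ℤ) ≤ ∑ i ∈ A ∩ A', n i - ∑ i ∈ B ∩ B', n i := by
      rw [hbp]; exact_mod_cast e2
    have hsum : ∑ i ∈ A, n i - ∑ i ∈ B, n i + (∑ i ∈ A', n i - ∑ i ∈ B', n i) =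
        ∑ i ∈ A ∩ A', n i - ∑ i ∈ B ∩ B', n i + (∑ i ∈ K, n i - ∑ i ∈ L, n i) := by
      have key : ∀ S : Finset ι, ∑ i ∈ S, n i = ∑ i, if i ∈ S then n i else 0 := by
        intro S; simp
      simp only [key, ← Finset.sum_sub_distrib, ← Finset.sum_add_distrib]
      refine Finset.sum_congr rfl fun i _ => ?_
      have h3 := hdisj i
      have h4 := hdisj' i
      simp only [hK, hL, Finset.mem_sdiff, Finset.mem_union, Finset.mem_inter]
      clear_value K L
      by_cases hiA : i ∈ A <;> by_cases hiA' : i ∈ A' <;> by_cases hiB : i ∈ B <;>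
        by_cases hiB' : i ∈ B' <;> simp [hiA, hiA', hiB, hiB'] at h3 h4 ⊢
    have : (b (A ∩ A') (B ∩ B') : ℤ) + b K L ≤ b A B + b A' B' := by linarith
    exact_mod_cast this
  · apply Set.Subset.antisymm
    · refine convexHull_min ?_ ?_
      · rintro _ ⟨m, hm, rfl⟩
        refine ⟨fun i => Int.cast_nonneg (hnonneg m hm i), fun A B _ => ?_⟩
        beta_reduce
        exact_mod_cast hbmax A B m hm
      · rintro x ⟨hx, hx'⟩ y ⟨hy, hy'⟩ a c ha hc hac
        refine ⟨fun i => ?_, fun A B hAB => ?_⟩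
        · have := mul_nonneg ha (hx i)
          have := mul_nonneg hc (hy i)
          simp only [Pi.add_apply, Pi.smul_apply, smul_eq_mul]; linarith
        · have h1 := mul_le_mul_of_nonneg_left (hx' A B hAB) ha
          have h2 := mul_le_mul_of_nonneg_left (hy' A B hAB) hc
          simp only [← pairing_sign hAB] at h1 h2 ⊢
          rw [pairing_add, pairing_smul, pairing_smul]
          calc _ ≤ a * (b A B : ℝ) + c * b A B := add_le_add h1 h2
            _ = b A B := by rw [← add_mul, hac, one_mul]
    · rintro x ⟨-, hx⟩
      refine mem_conv_of_forall_pairing hJ (exists_max_of_polyhedron hJ hne hjump ?_)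
      intro A B hAB
      obtain ⟨n, hn, hbn⟩ := hb A B
      refine ⟨n, hn, (hx A B hAB).trans (le_of_eq ?_)⟩
      simp only [toReal]
      exact_mod_cast hbn

end Polyhedron

/-! ### Packings of openly disjoint paths between pairwise nonadjacent terminals -/

section Packing

variable {W : Type*}

/-- `p` and `q` are consecutive, in this or in the other order, in the list `l`. -/
def Link (l : List W) (p q : W) : Prop := [p, q] <:+: l ∨ [q, p] <:+: l

lemma Link.left_mem {l : List W} {p q : W} (h : Link l p q) : p ∈ l := by
  rcases h with h | h <;> exact h.subset (by simp)

lemma Link.right_mem {l : List W} {p q : W} (h : Link l p q) : q ∈ l := by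
  rcases h with h | h <;> exact h.subset (by simp)

lemma link_reverse {l : List W} {p q : W} : Link l.reverse p q ↔ Link l p q := by
  have h : ∀ a b : W, [a, b] <:+: l.reverse ↔ [b, a] <:+: l := fun a b => by
    rw [← List.reverse_infix (l₂ := l)]; simp
  simp only [Link, h, or_comm]

lemma infix_pair_append_cons {p q v : W} {l₁ l₂ : List W} (h : [p, q] <:+: l₁ ++ v :: l₂) :
    [p, q] <:+: l₁ ++ [v] ∨ [p, q] <:+: v :: l₂ := by
  induction l₁ with
  | nil => exact Or.inr h
  | cons a l₁ ih =>
    rw [List.cons_append, List.infix_cons_iff] at h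
    rcases h with h | h
    · left
      refine List.IsPrefix.isInfix ?_
      cases l₁ <;> simp_all [List.cons_prefix_cons]
    · exact (ih h).imp List.infix_cons id

lemma infix_pair_concat {p q v : W} {l : List W} (h : [p, q] <:+: l ++ [v]) : p ∈ l := by
  obtain ⟨s, t, h⟩ := h
  rcases List.eq_nil_or_concat t with rfl | ⟨t, b, rfl⟩
  · have : (s ++ [p]) ++ [q] = l ++ [v] := by simpa using h
    rw [← (List.append_inj' this rfl).1]; simp
  · have : (s ++ [p, q] ++ t) ++ [b] = l ++ [v] := by simpa using h
    rw [← (List.append_inj' this rfl).1]; simp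

lemma exists_first_mem {l : List W} {H : W → Prop} (h : ∃ u ∈ l, H u) :
    ∃ l₁ v l₂, l = l₁ ++ v :: l₂ ∧ H v ∧ ∀ u ∈ l₁, ¬ H u := by
  classical
  induction l with
  | nil => simp at h
  | cons a l ih =>
    by_cases ha : H a
    · exact ⟨[], a, l, rfl, ha, by simp⟩
    · obtain ⟨l₁, v, l₂, rfl, hv, hl⟩ := ih (by simpa [ha] using h)
      exact ⟨a :: l₁, v, l₂, rfl, hv, by simpa [ha] using hl⟩

variable (A : W → W → Prop) (T : Set W)

/-- `l` lists the vertices of a path from `s` to `t` for the adjacency relation `A` that meets `T`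
in its two distinct endpoints only. -/
def IsTerminalPath (l : List W) (s t : W) : Prop :=
  ∃ mid : List W, l = s :: (mid ++ [t]) ∧ s ∈ T ∧ t ∈ T ∧ s ≠ t ∧ (∀ x ∈ mid, x ∉ T) ∧
    mid.Nodup ∧ l.IsChain A

/-- A set of openly disjoint paths with endpoints in `T`. -/
def IsPacking (P : Finset (List W)) : Prop :=
  (∀ l ∈ P, ∃ s t, IsTerminalPath A T l s t) ∧
    ∀ l ∈ P, ∀ l' ∈ P, ∀ x, x ∉ T → x ∈ l → x ∈ l' → l = l'

open Classical in
/-- The number of members of `P` that contain `w`. -/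
noncomputable def deg (P : Finset (List W)) (w : W) : ℤ := ∑ l ∈ P, if w ∈ l then 1 else 0

open Classical in
/-- The indicator function of the point `a`. -/
noncomputable def ind (a w : W) : ℤ := if w = a then 1 else 0

/-- The edge `pq` is used by the packing `P`. -/
def Uses (P : Finset (List W)) (p q : W) : Prop := ∃ l ∈ P, Link l p q

/-- The edges used by `P` and not by `Q`. -/
def excess (P Q : Finset (List W)) : Set (W × W) := {e | Uses P e.1 e.2 ∧ ¬ Uses Q e.1 e.2}

/-- One can move from the degree vector of `P` by the step `ε` at `i` and then by one more step
towards the degree vector of `Q`. -/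
def CanStep (P Q : Finset (List W)) (i : W) (ε : ℤ) : Prop :=
  ∃ P' j δ, IsPacking A T P' ∧ j ∈ T ∧ (δ = 1 ∨ δ = -1) ∧
    0 < δ * (deg Q j - (deg P j + ε * ind i j)) ∧
    ∀ w ∈ T, deg P' w = deg P w + ε * ind i w + δ * ind j w

variable {A T}

@[simp] lemma ind_self (a : W) : ind a a = 1 := by simp [ind]

lemma ind_of_ne {a w : W} (h : w ≠ a) : ind a w = 0 := by simp [ind, h]

/-- This chains the recursion. If passing from `P` to `P'` makes the step `ε` at `i` but overshoots
at `a`, the correcting step `ε'` at `a` lands where the first step from `P` should have landed, so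
the second step found from `P'` serves `P` as well. -/
lemma CanStep.congr {P P' Q : Finset (List W)} {a i : W} {ε ε' : ℤ} (ha : CanStep A T P' Q a ε')
    (h : ∀ w ∈ T, deg P' w + ε' * ind a w = deg P w + ε * ind i w) : CanStep A T P Q i ε := by
  obtain ⟨P'', j, δ, hP, hj, hδ, hpos, hdeg⟩ := ha
  exact ⟨P'', j, δ, hP, hj, hδ, by rwa [← h j hj], fun w hw => by rw [hdeg w hw, h w hw]⟩

lemma excess_finite (P Q : Finset (List W)) : (excess P Q).Finite := by
  classical
  refine ((P.biUnion List.toFinset) ×ˢ (P.biUnion List.toFinset)).finite_toSet.subset ?_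
  rintro ⟨p, q⟩ ⟨⟨l, hl, h⟩, -⟩
  exact Finset.mem_product.2
    ⟨Finset.mem_biUnion.2 ⟨l, hl, List.mem_toFinset.2 h.left_mem⟩,
      Finset.mem_biUnion.2 ⟨l, hl, List.mem_toFinset.2 h.right_mem⟩⟩

/-- The measure for the recursion: edges of `Q` may enter the packing freely, so it is enough that
one edge outside `Q` disappears and no new one appears. -/
lemma ncard_excess_lt {P P' Q : Finset (List W)}
    (h : ∀ p q, Uses P' p q → Uses P p q ∨ Uses Q p q) {p q : W} (hP : Uses P p q)
    (hQ : ¬ Uses Q p q) (hP' : ¬ Uses P' p q) : (excess P' Q).ncard < (excess P Q).ncard := by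
  refine Set.ncard_lt_ncard ⟨?_, ?_⟩ (excess_finite P Q)
  · rintro ⟨a, b⟩ ⟨h1, h2⟩
    exact ⟨(h a b h1).resolve_right h2, h2⟩
  · intro hsub
    exact hP' (hsub (show (p, q) ∈ excess P Q from ⟨hP, hQ⟩)).1

namespace IsTerminalPath

variable {l : List W} {s t : W}

lemma left_mem (h : IsTerminalPath A T l s t) : s ∈ l := by
  obtain ⟨mid, rfl, -⟩ := h; simp

lemma right_mem (h : IsTerminalPath A T l s t) : t ∈ l := by
  obtain ⟨mid, rfl, -⟩ := h; simp

lemma mem_iff (h : IsTerminalPath A T l s t) {w : W} (hw : w ∈ T) : w ∈ l ↔ w = s ∨ w = t := by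
  obtain ⟨mid, rfl, -, -, -, hmid, -⟩ := h
  have : w ∉ mid := fun h => hmid w h hw
  simp [this]

lemma indicator (h : IsTerminalPath A T l s t) {w : W} (hw : w ∈ T) [Decidable (w ∈ l)] :
    (if w ∈ l then 1 else 0 : ℤ) = ind s w + ind t w := by
  have hst : s ≠ t := by obtain ⟨mid, -, -, -, h, -⟩ := h; exact h
  by_cases h1 : w = s
  · subst h1; simp [ind, hst, h.left_mem]
  · by_cases h2 : w = t
    · subst h2; simp [ind, hst.symm, h.right_mem]
    · simp [ind, h1, h2, h.mem_iff hw]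

lemma reverse (hA : ∀ x y, A x y → A y x) (h : IsTerminalPath A T l s t) :
    IsTerminalPath A T l.reverse t s := by
  obtain ⟨mid, rfl, hs, ht, hst, hmid, hnd, hc⟩ := h
  refine ⟨mid.reverse, by simp, ht, hs, hst.symm, by simpa using hmid, List.nodup_reverse.2 hnd, ?_⟩
  rw [List.isChain_reverse]
  exact hc.imp fun a b h => hA _ _ h

lemma nodup (h : IsTerminalPath A T l s t) : l.Nodup := by
  obtain ⟨mid, rfl, hs, ht, hst, hmid, hnd, -⟩ := h
  have hs' : s ∉ mid := fun h => hmid s h hs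
  have ht' : t ∉ mid := fun h => hmid t h ht
  simp only [List.nodup_cons, List.mem_append, List.mem_singleton, hs', hst, or_self,
    not_false_eq_true, List.nodup_append, hnd, true_and]
  simpa using fun a ha => ne_of_mem_of_not_mem ha ht'

lemma adj_of_link (hA : ∀ x y, A x y → A y x) (h : IsTerminalPath A T l s t) {p q : W}
    (hl : Link l p q) : A p q := by
  obtain ⟨mid, -, -, -, -, -, -, hc⟩ := h
  rcases hl with hl | hl
  · simpa using hc.infix hl
  · exact hA _ _ (by simpa using hc.infix hl)

lemma exists_link (h : IsTerminalPath A T l s t) : ∃ y, Link l s y := by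
  obtain ⟨mid, rfl, -⟩ := h
  cases mid with
  | nil => exact ⟨t, Or.inl List.infix_rfl⟩
  | cons a mid => exact ⟨a, Or.inl ⟨[], mid ++ [t], by simp⟩⟩

lemma link_unique (h : IsTerminalPath A T l s t) {y y' : W} (h1 : Link l s y)
    (h2 : Link l s y') : y = y' := by
  have hnd := h.nodup
  obtain ⟨mid, rfl, -⟩ := h
  have key : ∀ y, Link (s :: (mid ++ [t])) s y → (mid ++ [t]).head? = some y := by
    have hs := (List.nodup_cons.1 hnd).1
    rintro y (hy | hy) <;> rw [List.infix_cons_iff] at hy <;> rcases hy with hy | hy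
    · obtain ⟨r, hr⟩ := hy
      have : mid ++ [t] = y :: r := by simpa using hr.symm
      simp [this]
    · exact absurd (hy.subset (by simp)) hs
    · obtain ⟨r, hr⟩ := hy
      have : y = s ∧ s :: r = mid ++ [t] := by simpa using hr
      exact absurd (this.2 ▸ List.mem_cons_self) hs
    · exact absurd (hy.subset (by simp)) hs
  have := (key y h1).symm.trans (key y' h2)
  simpa using this

end IsTerminalPath

/-! ### Orienting and rerouting members of a packing -/

/-- The lists `l` and `l'` trace the same undirected path. -/
def SameTrack (l l' : List W) : Prop :=
  (∀ x, x ∈ l ↔ x ∈ l') ∧ ∀ p q, Link l p q ↔ Link l' p q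

lemma SameTrack.refl (l : List W) : SameTrack l l := ⟨fun _ => Iff.rfl, fun _ _ => Iff.rfl⟩

lemma SameTrack.reverse {l l' : List W} (h : SameTrack l l') : SameTrack l.reverse l' :=
  ⟨fun x => by rw [List.mem_reverse, h.1], fun p q => by rw [link_reverse, h.2]⟩

section

variable {P Q : Finset (List W)}

lemma IsPacking.exists_oriented (hA : ∀ x y, A x y → A y x) (hP : IsPacking A T P) {l : List W}
    (hl : l ∈ P) {i : W} (hi : i ∈ T) (hil : i ∈ l) :
    ∃ l' z, IsTerminalPath A T l' i z ∧ SameTrack l' l := by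
  obtain ⟨s, t, h⟩ := hP.1 l hl
  rcases (h.mem_iff hi).1 hil with rfl | rfl
  · exact ⟨l, t, h, .refl l⟩
  · exact ⟨l.reverse, s, h.reverse hA, (SameTrack.refl l).reverse⟩

/-- A terminal of larger degree in `Q` than in `P` has an edge of `Q` that `P` does not use. -/
lemma exists_unused_of_deg_lt (hA : ∀ x y, A x y → A y x) (hT : ∀ x ∈ T, ∀ y ∈ T, ¬ A x y)
    (hP : IsPacking A T P) (hQ : IsPacking A T Q) {i : W} (hi : i ∈ T)
    (hlt : deg P i < deg Q i) :
    ∃ l ∈ Q, i ∈ l ∧ ∀ y, Link l i y → ¬ Uses P i y := by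
  classical
  have : Nonempty W := ⟨i⟩
  -- Otherwise send each member of `Q` at `i` to a member of `P` sharing its edge at `i`. This is
  -- injective: a path has one edge at its end `i`, and the other end of that edge is a
  -- non-terminal, hence lies on only one member of `Q`.
  by_contra! hcon
  refine absurd hlt (not_lt.2 ?_)
  choose! y hy using hcon
  have hy' : ∀ l, l ∈ Q → i ∈ l → ∃ r ∈ P, Link r i (y l) := fun l h1 h2 => (hy l h1 h2).2
  choose! f hf using hy'
  simp only [deg, Finset.sum_boole]
  norm_cast
  refine Finset.card_le_card_of_injOn f ?_ ?_
  · intro l hl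
    simp only [Finset.coe_filter, Set.mem_ofPred_eq] at hl ⊢
    exact ⟨(hf l hl.1 hl.2).1, (hf l hl.1 hl.2).2.left_mem⟩
  · intro l hl l' hl' he
    simp only [Finset.coe_filter, Set.mem_ofPred_eq] at hl hl'
    have h1 := hf l hl.1 hl.2
    have h2 := hf l' hl'.1 hl'.2
    obtain ⟨r, z, hr, hrt⟩ := hP.exists_oriented hA h1.1 hi h1.2.left_mem
    have hyy : y l = y l' :=
      hr.link_unique ((hrt.2 _ _).2 h1.2) ((hrt.2 _ _).2 (by rw [he]; exact h2.2))
    have hadj : A i (y l) := hr.adj_of_link hA ((hrt.2 _ _).2 h1.2)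
    refine hQ.2 l hl.1 l' hl'.1 (y l) (fun h => hT i hi _ h hadj) (hy l hl.1 hl.2).1.right_mem ?_
    rw [hyy]
    exact (hy l' hl'.1 hl'.2).1.right_mem

lemma deg_erase [DecidableEq (List W)] {l r : List W} (hl : l ∈ P) {s t : W}
    (hr : IsTerminalPath A T r s t) (hrl : SameTrack r l) {w : W} (hw : w ∈ T) :
    deg (P.erase l) w = deg P w - ind s w - ind t w := by
  classical
  unfold deg
  have := Finset.add_sum_erase P (fun l => if w ∈ l then (1 : ℤ) else 0) hl
  have h2 := hr.indicator hw
  simp only [hrl.1] at h2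
  simp only [h2] at this
  linarith

lemma deg_insert [DecidableEq (List W)] {l r : List W} (hl : l ∉ P) {s t : W}
    (hr : IsTerminalPath A T r s t) (hrl : SameTrack r l) {w : W} (hw : w ∈ T) :
    deg (insert l P) w = deg P w + ind s w + ind t w := by
  classical
  unfold deg
  rw [Finset.sum_insert hl]
  have h2 := hr.indicator hw
  simp only [hrl.1] at h2
  rw [h2]
  ring

lemma IsPacking.subset {P' : Finset (List W)} (hP : IsPacking A T P) (h : P' ⊆ P) :
    IsPacking A T P' :=
  ⟨fun l hl => hP.1 l (h hl), fun l hl l' hl' => hP.2 l (h hl) l' (h hl')⟩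

lemma IsPacking.insert [DecidableEq (List W)] (hP : IsPacking A T P) {l : List W} {s t : W}
    (hl : IsTerminalPath A T l s t) (hdisj : ∀ x ∈ l, x ∉ T → ∀ r ∈ P, x ∉ r) :
    IsPacking A T (insert l P) := by
  refine ⟨?_, ?_⟩
  · intro r hr
    rcases Finset.mem_insert.1 hr with rfl | hr
    · exact ⟨s, t, hl⟩
    · exact hP.1 r hr
  · intro r hr r' hr' x hx hxr hxr'
    rcases Finset.mem_insert.1 hr with h | h <;> rcases Finset.mem_insert.1 hr' with h' | h'
    · exact h.trans h'.symm
    · exact absurd hxr' (hdisj x (h ▸ hxr) hx _ h')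
    · exact absurd hxr (hdisj x (h' ▸ hxr') hx _ h)
    · exact hP.2 r h r' h' x hx hxr hxr'

/-- If a path that ends in a vertex of the member `Z` of `Q` has all its edges in `Q`, then its
first edge belongs to `Z`. -/
lemma exists_link_of_forall_uses (hQ : IsPacking A T Q) {Z Z₀ : List W} (hZ₀ : Z₀ ∈ Q)
    (hZ : SameTrack Z Z₀) {v : W} (hvZ : v ∈ Z) (hv : v ∉ T) (N : List W) :
    ∀ x, (∀ u ∈ N, u ∉ T) → (∀ p q, [p, q] <:+: x :: (N ++ [v]) → Uses Q p q) →
    ∃ y, [x, y] <:+: x :: (N ++ [v]) ∧ Link Z x y := by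
  -- A non-terminal lies on at most one member of `Q`, so an edge of `Q` at a non-terminal of `Z`
  -- belongs to `Z`. Walking back from `v`, the path never leaves `Z`.
  have key : ∀ p q, q ∈ Z → q ∉ T → Uses Q p q → Link Z p q := by
    rintro p q hqZ hq ⟨l, hl, hlink⟩
    rw [hZ.2, hQ.2 Z₀ hZ₀ l hl q hq ((hZ.1 q).1 hqZ) hlink.right_mem]
    exact hlink
  induction N with
  | nil =>
    intro x _ h
    have hpre : [x, v] <:+: x :: ([] ++ [v]) := List.infix_rfl
    exact ⟨v, hpre, key x v hvZ hv (h _ _ hpre)⟩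
  | cons n N ih =>
    intro x hN h
    obtain ⟨y, -, hy⟩ := ih n (fun u hu => hN u (by simp [hu]))
      (fun p q hpq => h p q (List.infix_cons hpq))
    have hpre : [x, n] <:+: x :: (n :: N ++ [v]) := ⟨[], N ++ [v], by simp⟩
    exact ⟨n, hpre, key x n hy.left_mem (hN n (by simp)) (h _ _ hpre)⟩

/-- A member of `P` that meets the member `Z` of `Q` at `v` can be oriented such that its part up to
`v` has an edge that `Q` does not use, and such that it does not end in the first vertex of `Z`. -/
lemma exists_oriented_split (hA : ∀ x y, A x y → A y x) (hP : IsPacking A T P)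
    (hQ : IsPacking A T Q) {Z Z₀ R₀ : List W} (hZ₀ : Z₀ ∈ Q) (hZ : SameTrack Z Z₀) {i z v : W}
    (hZp : IsTerminalPath A T Z i z) (hfirst : ∀ y, Link Z i y → ¬ Uses P i y) (hvZ : v ∈ Z)
    (hv : v ∉ T) (hR₀ : R₀ ∈ P) (hvR : v ∈ R₀) :
    ∃ R x y N₁ N₂, SameTrack R R₀ ∧ R = x :: (N₁ ++ v :: (N₂ ++ [y])) ∧
      IsTerminalPath A T R x y ∧ y ≠ i ∧ ∃ p q, [p, q] <:+: x :: (N₁ ++ [v]) ∧ ¬ Uses Q p q := by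
  -- If the part from `x` to `v` lies in `Q`, it runs along `Z`, so `x` is an end of `Z`. It cannot
  -- be `i`, since `P` does not use the first edge of `Z`.
  have key : ∀ R x y N₁ N₂, SameTrack R R₀ → R = x :: (N₁ ++ v :: (N₂ ++ [y])) →
      IsTerminalPath A T R x y → (∀ p q, [p, q] <:+: x :: (N₁ ++ [v]) → Uses Q p q) → x = z := by
    intro R x y N₁ N₂ hR hReq hRp hall
    have hN : ∀ u ∈ N₁, u ∉ T := by
      obtain ⟨mid, hmid, -, -, -, hmidT, -⟩ := hRp
      have : (N₁ ++ v :: N₂) ++ [y] = mid ++ [y] := by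
        rw [hReq] at hmid; simpa using hmid
      intro u hu
      refine hmidT u ?_
      rw [← List.append_cancel_right this]
      simp [hu]
    obtain ⟨y', hy', hlink⟩ := exists_link_of_forall_uses hQ hZ₀ hZ hvZ hv N₁ x hN hall
    have hxT : x ∈ T := by obtain ⟨mid, -, h, -⟩ := hRp; exact h
    rcases (hZp.mem_iff hxT).1 hlink.left_mem with rfl | h
    · refine absurd ⟨R₀, hR₀, (hR.2 _ _).1 (Or.inl ?_)⟩ (hfirst y' hlink)
      refine hy'.trans ⟨[], N₂ ++ [y], ?_⟩
      simp [hReq]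
    · exact h
  obtain ⟨x, y, hRp⟩ := hP.1 R₀ hR₀
  have hRp' := hRp
  obtain ⟨mid, hmid, hxT, hyT, hxy, -⟩ := hRp'
  have hvmid : v ∈ mid := by
    rw [hmid] at hvR
    have h1 : v ≠ x := fun h => hv (h ▸ hxT)
    have h2 : v ≠ y := fun h => hv (h ▸ hyT)
    simpa [h1, h2] using hvR
  obtain ⟨N₁, N₂, rfl⟩ := List.append_of_mem hvmid
  have hR₀eq : R₀ = x :: (N₁ ++ v :: (N₂ ++ [y])) := by simpa using hmid
  have hrev : R₀.reverse = y :: (N₂.reverse ++ v :: (N₁.reverse ++ [x])) := by simp [hR₀eq]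
  have hzi : i ≠ z := by obtain ⟨mid, -, -, -, h, -⟩ := hZp; exact h
  -- If this orientation fails, then `y = i` or, by `key`, `x = z`. Either way `x ≠ i` and `y ≠ z`,
  -- so the reversed orientation works.
  by_cases hgood : y ≠ i ∧ ∃ p q, [p, q] <:+: x :: (N₁ ++ [v]) ∧ ¬ Uses Q p q
  · exact ⟨R₀, x, y, N₁, N₂, .refl _, hR₀eq, hRp, hgood⟩
  · have hsame : SameTrack R₀.reverse R₀ := (SameTrack.refl R₀).reverse
    have hyx : x ≠ i ∧ y ≠ z := by
      rw [not_and_or, not_not] at hgood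
      rcases hgood with h | h
      · exact ⟨h ▸ hxy, h ▸ hzi⟩
      · push Not at h
        have := key R₀ x y N₁ N₂ (.refl _) hR₀eq hRp h
        exact ⟨this ▸ hzi.symm, this ▸ hxy.symm⟩
    refine ⟨R₀.reverse, y, x, N₂.reverse, N₁.reverse, hsame, hrev, hRp.reverse hA, hyx.1, ?_⟩
    by_contra! h
    exact hyx.2 (key _ y x _ _ hsame hrev (hRp.reverse hA) h)

/-- Following a path `Z` up to its first vertex `v` on the path `R`, and `R` from there on. -/
lemma IsTerminalPath.splice {Z R M₁ M₂ N₁ N₂ : List W} {i z x y v : W}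
    (hZ : IsTerminalPath A T Z i z) (hZeq : Z = i :: (M₁ ++ v :: (M₂ ++ [z])))
    (hR : IsTerminalPath A T R x y) (hReq : R = x :: (N₁ ++ v :: (N₂ ++ [y]))) (hyi : y ≠ i)
    (hM : ∀ u ∈ M₁, u ∉ R) : IsTerminalPath A T (i :: (M₁ ++ v :: (N₂ ++ [y]))) i y := by
  obtain ⟨mid, hmid, hiT, -, -, hmidT, hmidnd, hZc⟩ := hZ
  obtain ⟨mid', hmid', -, hyT, -, hmidT', hmidnd', hRc⟩ := hR
  obtain rfl : M₁ ++ v :: M₂ = mid := by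
    have : (M₁ ++ v :: M₂) ++ [z] = mid ++ [z] := by rw [hZeq] at hmid; simpa using hmid
    exact List.append_cancel_right this
  obtain rfl : N₁ ++ v :: N₂ = mid' := by
    have : (N₁ ++ v :: N₂) ++ [y] = mid' ++ [y] := by rw [hReq] at hmid'; simpa using hmid'
    exact List.append_cancel_right this
  refine ⟨M₁ ++ v :: N₂, by simp, hiT, hyT, hyi.symm, ?_, ?_, ?_⟩
  · intro u hu
    simp only [List.mem_append] at hu
    rcases hu with hu | hu
    · exact hmidT u (by simp [hu])
    · exact hmidT' u (by simp [hu])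
  · rw [List.nodup_append]
    refine ⟨(List.nodup_append.1 hmidnd).1, (List.nodup_append.1 hmidnd').2.1, ?_⟩
    rintro a ha b hb rfl
    refine hM a ha ?_
    rw [hReq]
    rcases List.mem_cons.1 hb with rfl | hb <;> simp [*]
  · rw [hZeq, ← List.cons_append, List.isChain_split] at hZc
    rw [hReq, ← List.cons_append, List.isChain_split] at hRc
    rw [← List.cons_append, List.isChain_split]
    exact ⟨hZc.1, hRc.2⟩

lemma link_splice {M₁ N₂ M₂ : List W} {i y z v p q : W}
    (h : Link (i :: (M₁ ++ v :: (N₂ ++ [y]))) p q) :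
    Link (i :: (M₁ ++ v :: (M₂ ++ [z]))) p q ∨ Link (v :: (N₂ ++ [y])) p q := by
  have key : ∀ p q, [p, q] <:+: i :: (M₁ ++ v :: (N₂ ++ [y])) →
      [p, q] <:+: i :: (M₁ ++ v :: (M₂ ++ [z])) ∨ [p, q] <:+: v :: (N₂ ++ [y]) := by
    intro p q h
    rw [← List.cons_append] at h
    refine (infix_pair_append_cons h).imp (fun h => h.trans ⟨[], M₂ ++ [z], ?_⟩) id
    simp
  rcases h with h | h
  · exact (key p q h).imp Or.inl Or.inl
  · exact (key q p h).imp Or.inr Or.inr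

/-! ### The exchange property -/

/-- The downward step, given the upward step from packings with fewer edges outside `Q`. -/
lemma canStep_neg (hA : ∀ x y, A x y → A y x) (hT : ∀ x ∈ T, ∀ y ∈ T, ¬ A x y)
    (hQ : IsPacking A T Q) {k : ℕ}
    (ih : ∀ P, IsPacking A T P → (excess P Q).ncard < k → ∀ i ∈ T, deg P i < deg Q i →
      CanStep A T P Q i 1)
    (hP : IsPacking A T P) (hk : (excess P Q).ncard ≤ k) {z : W} (hz : z ∈ T)
    (hlt : deg Q z < deg P z) : CanStep A T P Q z (-1) := by
  classical
  -- With the roles of `P` and `Q` exchanged, this yields a member of `P` whose edge at `z` is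
  -- outside `Q`; deleting it lowers the excess.
  obtain ⟨R₀, hR₀, hzR, hun⟩ := exists_unused_of_deg_lt hA hT hQ hP hz hlt
  obtain ⟨R, b, hR, hsame⟩ := hP.exists_oriented hA hR₀ hz hzR
  obtain ⟨y, hy⟩ := hR.exists_link
  have hyT : y ∉ T := fun h => hT z hz y h (hR.adj_of_link hA hy)
  rw [hsame.2] at hy
  have hP' : IsPacking A T (P.erase R₀) := hP.subset (Finset.erase_subset _ _)
  have hdeg : ∀ w ∈ T, deg (P.erase R₀) w = deg P w - ind z w - ind b w :=
    fun w hw => deg_erase hR₀ hR hsame hw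
  have hlt' : (excess (P.erase R₀) Q).ncard < (excess P Q).ncard := by
    refine ncard_excess_lt ?_ (p := z) (q := y) ⟨R₀, hR₀, hy⟩ (hun y hy) ?_
    · rintro p q ⟨l, hl, h⟩
      exact Or.inl ⟨l, Finset.mem_of_mem_erase hl, h⟩
    · rintro ⟨l, hl, h⟩
      exact (Finset.ne_of_mem_erase hl)
        (hP.2 l (Finset.mem_of_mem_erase hl) R₀ hR₀ y hyT h.right_mem hy.right_mem)
  have hbT : b ∈ T := by obtain ⟨mid, -, -, h, -⟩ := hR; exact h
  have hzb : z ≠ b := by obtain ⟨mid, -, -, -, h, -⟩ := hR; exact h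
  -- The loss at the other end `b` is either the wanted second step or creates a deficit there,
  -- which the upward step from the smaller excess repairs.
  by_cases hb : deg Q b < deg P b
  · refine ⟨_, b, -1, hP', hbT, Or.inr rfl, ?_, fun w hw => by rw [hdeg w hw]; ring⟩
    rw [ind_of_ne hzb.symm]; linarith
  · refine (ih _ hP' (hlt'.trans_le hk) b hbT ?_).congr fun w hw => by rw [hdeg w hw]; ring
    rw [hdeg b hbT, ind_of_ne hzb.symm, ind_self]; linarith

/-- The upward step towards the degree vector of `Q`. -/
theorem canStep_pos (hA : ∀ x y, A x y → A y x) (hT : ∀ x ∈ T, ∀ y ∈ T, ¬ A x y)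
    (hQ : IsPacking A T Q) (hP : IsPacking A T P) {i : W} (hi : i ∈ T)
    (hlt : deg P i < deg Q i) : CanStep A T P Q i 1 := by
  classical
  induction hk : (excess P Q).ncard using Nat.strong_induction_on generalizing P i with
  | _ k ih =>
  replace ih : ∀ P, IsPacking A T P → (excess P Q).ncard < k → ∀ i ∈ T, deg P i < deg Q i →
      CanStep A T P Q i 1 := fun P hP hk i hi hlt => ih _ hk hP hi hlt rfl
  obtain ⟨Z₀, hZ₀, hiZ, hun⟩ := exists_unused_of_deg_lt hA hT hP hQ hi hlt
  obtain ⟨Z, z, hZ, hsame⟩ := hQ.exists_oriented hA hZ₀ hi hiZ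
  have hfirst : ∀ y, Link Z i y → ¬ Uses P i y := fun y hy => hun y ((hsame.2 _ _).1 hy)
  have hzT : z ∈ T := by obtain ⟨mid, -, -, h, -⟩ := hZ; exact h
  have hiz : i ≠ z := by obtain ⟨mid, -, -, -, h, -⟩ := hZ; exact h
  obtain ⟨mid, hmid, -, -, -, hmidT, -, -⟩ := id hZ
  by_cases hhit : ∃ u ∈ mid, ∃ r ∈ P, u ∈ r
  · obtain ⟨M₁, v, M₂, rfl, ⟨R₀, hR₀, hvR⟩, hM₁⟩ := exists_first_mem hhit
    have hv : v ∉ T := hmidT v (by simp)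
    have hZeq : Z = i :: (M₁ ++ v :: (M₂ ++ [z])) := by simpa using hmid
    obtain ⟨R, x, y, N₁, N₂, hRR, hReq, hR, hyi, p, q, hpq, hpqQ⟩ :=
      exists_oriented_split hA hP hQ hZ₀ hsame hZ hfirst (by simp [hZeq]) hv hR₀ hvR
    set N := i :: (M₁ ++ v :: (N₂ ++ [y])) with hN
    have hNp : IsTerminalPath A T N i y := hZ.splice hZeq hR hReq hyi fun u hu huR =>
      hM₁ u hu ⟨R₀, hR₀, (hRR.1 u).1 huR⟩
    have hNdisj : ∀ u ∈ N, u ∉ T → ∀ r ∈ P.erase R₀, u ∉ r := by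
      intro u hu huT r hr hur
      have hrP := Finset.mem_of_mem_erase hr
      have hcase : u ∈ M₁ ∨ u ∈ R := by
        have h1 : u ≠ i := fun h => huT (h ▸ hi)
        simp only [hN, List.mem_cons, h1, List.mem_append, false_or] at hu
        rcases hu with hu | hu
        · exact Or.inl hu
        · right; rw [hReq]; simp only [List.mem_cons, List.mem_append]; tauto
      rcases hcase with h | h
      · exact hM₁ u h ⟨r, hrP, hur⟩
      · exact Finset.ne_of_mem_erase hr (hP.2 r hrP R₀ hR₀ u huT hur ((hRR.1 u).1 h))
    have hNnot : N ∉ P.erase R₀ := fun h => hNdisj v (by simp [hN]) hv N h (by simp [hN])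
    have hP' : IsPacking A T (insert N (P.erase R₀)) :=
      (hP.subset (Finset.erase_subset _ _)).insert hNp hNdisj
    have hdeg : ∀ w ∈ T, deg (insert N (P.erase R₀)) w = deg P w + ind i w - ind x w := by
      intro w hw
      rw [deg_insert hNnot hNp (.refl N) hw, deg_erase hR₀ hR hRR hw]; ring
    have hRsplit : ∀ a b, Link (v :: (N₂ ++ [y])) a b → Link R a b := by
      have hinf : v :: (N₂ ++ [y]) <:+: R := ⟨x :: N₁, [], by simp [hReq]⟩
      intro a b h
      exact h.imp (fun h => h.trans hinf) fun h => h.trans hinf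
    have hNlink : ∀ a b, Link N a b → Uses Q a b ∨ Link (v :: (N₂ ++ [y])) a b := by
      intro a b h
      refine (link_splice (M₂ := M₂) (z := z) h).imp (fun h => ?_) id
      rw [← hZeq] at h
      exact ⟨Z₀, hZ₀, (hsame.2 _ _).1 h⟩
    have hpR : p ∈ x :: N₁ := infix_pair_concat (by simpa using hpq)
    have hpqR : Link R p q := Or.inl (hpq.trans ⟨[], N₂ ++ [y], by simp [hReq]⟩)
    -- New edges come from `Z`, hence from `Q`. The edge `pq` outside `Q` lies on the discarded half
    -- of `R`; it is not on the kept half, since `R` has no repeated vertex, nor on another member,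
    -- since one of its ends is a non-terminal.
    have hlt' : (excess (insert N (P.erase R₀)) Q).ncard < (excess P Q).ncard := by
      refine ncard_excess_lt ?_ (p := p) (q := q) ⟨R₀, hR₀, (hRR.2 _ _).1 hpqR⟩ hpqQ ?_
      · rintro a b ⟨l, hl, h⟩
        rcases Finset.mem_insert.1 hl with rfl | hl
        · rcases hNlink a b h with h | h
          · exact Or.inr h
          · exact Or.inl ⟨R₀, hR₀, (hRR.2 _ _).1 (hRsplit a b h)⟩
        · exact Or.inl ⟨l, Finset.mem_of_mem_erase hl, h⟩
      · rintro ⟨l, hl, h⟩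
        rcases Finset.mem_insert.1 hl with rfl | hl
        · have hmem := ((hNlink p q h).resolve_left hpqQ).left_mem
          have hnd := hR.nodup
          rw [hReq, ← List.cons_append, List.nodup_append] at hnd
          exact hnd.2.2 p hpR p hmem rfl
        · have hlP := Finset.mem_of_mem_erase hl
          have hadj := hR.adj_of_link hA hpqR
          have hex : ∃ u, u ∉ T ∧ u ∈ l ∧ u ∈ R := by
            by_cases hp : p ∈ T
            · exact ⟨q, fun hq => hT p hp q hq hadj, h.right_mem, hpqR.right_mem⟩
            · exact ⟨p, hp, h.left_mem, hpqR.left_mem⟩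
          obtain ⟨u, huT, hul, huR⟩ := hex
          exact Finset.ne_of_mem_erase hl (hP.2 l hlP R₀ hR₀ u huT hul ((hRR.1 u).1 huR))
    have hxT : x ∈ T := by obtain ⟨mid, -, h, -⟩ := hR; exact h
    -- Rerouting moves one end from `x` to `i`. If `x = i`, no degree has changed and the recursion
    -- starts again at `i`; otherwise the loss at `x` is the second step or a deficit to repair.
    by_cases hxi : x = i
    · subst hxi
      refine (ih _ hP' (hk ▸ hlt') x hi ?_).congr fun w hw => by rw [hdeg w hw]; ring
      rw [hdeg x hi]; linarith
    · by_cases hx : deg Q x < deg P x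
      · refine ⟨_, x, -1, hP', hxT, Or.inr rfl, ?_, fun w hw => by rw [hdeg w hw]; ring⟩
        rw [ind_of_ne hxi]; linarith
      · refine (ih _ hP' (hk ▸ hlt') x hxT ?_).congr fun w hw => by rw [hdeg w hw]; ring
        rw [hdeg x hxT, ind_of_ne hxi, ind_self]; linarith
  · have hZ₀p : ∃ s t, IsTerminalPath A T Z₀ s t := hQ.1 Z₀ hZ₀
    obtain ⟨s, t, hst⟩ := hZ₀p
    have hdisj : ∀ u ∈ Z₀, u ∉ T → ∀ r ∈ P, u ∉ r := by
      intro u hu huT r hr hur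
      refine hhit ⟨u, ?_, r, hr, hur⟩
      rw [← hsame.1, hmid] at hu
      have h1 : u ≠ i := fun h => huT (h ▸ hi)
      have h2 : u ≠ z := fun h => huT (h ▸ hzT)
      simpa [h1, h2] using hu
    have hnot : Z₀ ∉ P := fun h => by
      obtain ⟨y, hy⟩ := hZ.exists_link
      exact hfirst y hy ⟨Z₀, h, (hsame.2 _ _).1 hy⟩
    have hP' : IsPacking A T (insert Z₀ P) := hP.insert hst hdisj
    have hdeg : ∀ w ∈ T, deg (insert Z₀ P) w = deg P w + ind i w + ind z w :=
      fun w hw => deg_insert hnot hZ hsame hw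
    by_cases hz : deg P z < deg Q z
    · refine ⟨_, z, 1, hP', hzT, Or.inl rfl, ?_, fun w hw => by rw [hdeg w hw]; ring⟩
      rw [ind_of_ne hiz.symm]; linarith
    -- Adding `Z` may overshoot at `z` without lowering the excess. The downward step at `z` still
    -- applies: it deletes an edge outside `Q` before it calls the induction hypothesis.
    · have hle : (excess (insert Z₀ P) Q).ncard ≤ k := by
        rw [← hk]
        refine Set.ncard_le_ncard ?_ (excess_finite P Q)
        rintro ⟨a, b⟩ ⟨⟨l, hl, h⟩, hab⟩
        rcases Finset.mem_insert.1 hl with rfl | hl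
        · exact absurd ⟨l, hZ₀, h⟩ hab
        · exact ⟨⟨l, hl, h⟩, hab⟩
      refine (canStep_neg hA hT hQ ih hP' hle hzT ?_).congr fun w hw => by rw [hdeg w hw]; ring
      rw [hdeg z hzT, ind_of_ne hiz.symm, ind_self]; linarith

end

/-- The degree vectors of packings of openly disjoint paths form a jump system of constant
parity. -/
theorem isParityJumpSystem_deg {ι : Type*} [DecidableEq ι] (hA : ∀ x y, A x y → A y x)
    (hT : ∀ x ∈ T, ∀ y ∈ T, ¬ A x y) (τ : ι → W) (hτ : Function.Injective τ)
    (hτT : Set.range τ = T) :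
    IsParityJumpSystem {m : ι → ℤ | ∃ P, IsPacking A T P ∧ ∀ i, m i = deg P (τ i)} := by
  rintro m ⟨P, hP, hm⟩ n ⟨Q, hQ, hn⟩ i ε hε hpos
  have hτm : ∀ i, τ i ∈ T := fun i => hτT ▸ ⟨i, rfl⟩
  have hind : ∀ (i j : ι) (ε : ℤ), ε * ind (τ i) (τ j) = (Pi.single i ε : ι → ℤ) j := by
    intro i j ε
    by_cases h : j = i
    · subst h; simp
    · rw [ind_of_ne (hτ.ne h), Pi.single_eq_of_ne h, mul_zero]
  have hstep : CanStep A T P Q (τ i) ε := by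
    rw [hm, hn] at hpos
    rcases hε with rfl | rfl
    · exact canStep_pos hA hT hQ hP (hτm i) (by linarith)
    · exact canStep_neg hA hT hQ (fun P hP _ i hi h => canStep_pos hA hT hQ hP hi h) hP le_rfl
        (hτm i) (by linarith)
  obtain ⟨P', j, δ, hP', hj, hδ, hpos', hdeg⟩ := hstep
  obtain ⟨j, rfl⟩ := hτT ▸ hj
  refine ⟨j, δ, hδ, ?_, P', hP', fun w => ?_⟩
  · simpa only [Pi.add_apply, hm, hn, hind] using hpos'
  · simp only [Pi.add_apply, hm, hdeg _ (hτm w), hind]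

end Packing

/-! ### Traversals and T-paths in a multigraph -/

variable {α β : Type*} {G P Q : Graph α β} {s t x y : α} {e : β} {vs : List α} {es : List β}

namespace Traverses

lemma left_mem (h : Traverses G s t vs es) : s ∈ vs := by cases h <;> simp

lemma right_mem (h : Traverses G s t vs es) : t ∈ vs := by
  induction h with
  | nil => simp
  | cons _ _ _ ih => simp [ih]

lemma edge_ends (h : Traverses G s t vs es) (he : e ∈ es) (hl : G.IsLink e x y) :
    x ≠ y ∧ x ∈ vs ∧ y ∈ vs := by
  induction h with
  | nil => simp at he
  | @cons a b c f vs es hf hp ha ih =>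
    rcases List.mem_cons.1 he with rfl | he
    · have hab : a ≠ b := fun h => ha (h ▸ hp.left_mem)
      have := hp.left_mem
      rcases hl.eq_and_eq_or_eq_and_eq hf with ⟨rfl, rfl⟩ | ⟨rfl, rfl⟩
      · exact ⟨hab, by simp, by simp [this]⟩
      · exact ⟨hab.symm, by simp [this], by simp⟩
    · obtain ⟨h1, h2, h3⟩ := ih he
      exact ⟨h1, by simp [h2], by simp [h3]⟩

lemma edge_mem (h : Traverses G s t vs es) (he : e ∈ es) : e ∈ E(G) := by
  induction h with
  | nil => simp at he
  | cons hf _ _ ih =>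
    rcases List.mem_cons.1 he with rfl | he
    · exact hf.edge_mem
    · exact ih he

lemma edges_nodup (h : Traverses G s t vs es) : es.Nodup := by
  induction h with
  | nil => simp
  | cons hf hp hx ih => exact List.nodup_cons.2 ⟨fun he => hx (hp.edge_ends he hf).2.1, ih⟩

lemma vertex_mem (h : Traverses G s t vs es) (hx : x ∈ vs) : x ∈ V(G) := by
  induction h with
  | nil h => simpa [List.mem_singleton.1 hx] using h
  | cons hf _ _ ih =>
    rcases List.mem_cons.1 hx with rfl | hx
    · exact hf.left_mem
    · exact ih hx

lemma of_isLink (h : Traverses G s t vs es) (hV : ∀ v ∈ vs, v ∈ V(P))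
    (hE : ∀ e ∈ es, ∀ x y, G.IsLink e x y → P.IsLink e x y) : Traverses P s t vs es := by
  induction h with
  | nil => exact .nil (hV _ (by simp))
  | cons hf hp hx ih =>
    exact .cons (hE _ (by simp) _ _ hf)
      (ih (fun v hv => hV v (by simp [hv])) fun e he => hE e (by simp [he])) hx

lemma mono (hPG : P ≤ G) (h : Traverses P s t vs es) : Traverses G s t vs es :=
  h.of_isLink (fun _ hv => hPG.1 (h.vertex_mem hv))
    fun _ _ _ _ hl => hl.mono hPG

lemma concat (h : Traverses G s x vs es) (he : G.IsLink e x y) (hy : y ∉ vs) :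
    Traverses G s y (vs ++ [y]) (es ++ [e]) := by
  induction h with
  | nil =>
    refine .cons he (.nil he.right_mem) ?_
    simpa [eq_comm] using hy
  | cons hf hp hx ih =>
    simp only [List.mem_cons, not_or] at hy
    refine .cons hf (ih he hy.2) ?_
    simpa [hx] using Ne.symm hy.1

lemma reverse (h : Traverses G s t vs es) : Traverses G t s vs.reverse es.reverse := by
  induction h with
  | nil hx => exact .nil hx
  | cons he hp hx ih =>
    rw [List.reverse_cons, List.reverse_cons]
    exact ih.concat he.symm (by simpa using hx)

lemma suffix (h : Traverses G s t vs es) (hx : x ∈ vs) :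
    ∃ vs' es', Traverses G x t vs' es' ∧ vs' ⊆ vs ∧ es' ⊆ es := by
  induction h with
  | nil h =>
    obtain rfl := List.mem_singleton.1 hx
    exact ⟨_, _, .nil h, List.Subset.refl _, List.Subset.refl _⟩
  | cons he hp ha ih =>
    rcases List.mem_cons.1 hx with rfl | hx
    · exact ⟨_, _, .cons he hp ha, List.Subset.refl _, List.Subset.refl _⟩
    · obtain ⟨vs', es', h, h1, h2⟩ := ih hx
      exact ⟨vs', es', h, List.subset_cons_of_subset _ h1, List.subset_cons_of_subset _ h2⟩

lemma eq_single_of_isLink (h : Traverses G s t vs es) (he : e ∈ es) (hl : G.IsLink e s t) :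
    vs = [s, t] ∧ es = [e] := by
  cases h with
  | nil => simp at he
  | cons hf hp hx =>
    rcases List.mem_cons.1 he with rfl | he
    · obtain rfl := hf.right_unique hl
      cases hp with
      | nil => simp
      | cons _ hp h => exact absurd hp.right_mem h
    · exact absurd (hp.edge_ends he hl).2.1 hx

/-- A traversal is one of a subgraph consisting of the traversed vertices and edges. -/
lemma exists_subgraph (h : Traverses G s t vs es) :
    ∃ P ≤ G, Traverses P s t vs es ∧ V(P) = {v | v ∈ vs} ∧ E(P) = {e | e ∈ es} := by
  let P : Graph α β :=
    { vertexSet := {v | v ∈ vs}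
      IsLink := fun e x y => G.IsLink e x y ∧ e ∈ es
      edgeSet := {e | e ∈ es}
      isLink_symm := fun e _ => ⟨fun x y h => ⟨h.1.symm, h.2⟩⟩
      eq_or_eq_of_isLink_of_isLink := fun _ _ _ _ _ h h' => h.1.left_eq_or_eq h'.1
      edge_mem_iff_exists_isLink := fun e => ⟨fun he => by
        obtain ⟨x, y, hl⟩ := Graph.exists_isLink_of_mem_edgeSet (h.edge_mem he)
        exact ⟨x, y, hl, he⟩, fun ⟨_, _, hl⟩ => hl.2⟩
      left_mem_of_isLink := fun _ _ _ hl => (h.edge_ends hl.2 hl.1).2.1 }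
  exact ⟨P, ⟨fun v hv => h.vertex_mem hv, fun _ _ _ hl => hl.1⟩,
    h.of_isLink (fun _ hv => hv) fun _ he _ _ hl => ⟨hl, he⟩, rfl, rfl⟩

end Traverses

namespace IsTPath

variable {T : Set α}

/-- A T-path meets T in its ends only and can be traversed from either, so counting ends at a
terminal amounts to counting the paths through it, as `deg` does. -/
lemma exists_isPathBetween_iff (h : IsTPath G T P) {t : α} (ht : t ∈ T) :
    (∃ s, IsPathBetween P t s) ↔ t ∈ V(P) := by
  constructor
  · rintro ⟨s, vs, es, htr, hV, -⟩
    rw [hV]; exact htr.left_mem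
  · intro htP
    obtain ⟨-, a, b, -, ⟨vs, es, htr, hV, hE⟩, hab⟩ := h
    have : t ∈ ({a, b} : Set α) := hab ▸ ⟨htP, ht⟩
    rcases this with rfl | rfl
    · exact ⟨b, vs, es, htr, hV, hE⟩
    · exact ⟨a, _, _, htr.reverse, by simp [hV], by simp [hE]⟩

lemma edgeSet_nonempty (h : IsTPath G T P) : ∃ e, e ∈ E(P) := by
  obtain ⟨-, a, b, hab, ⟨vs, es, htr, hV, hE⟩, -⟩ := h
  cases htr with
  | nil => exact absurd rfl hab
  | cons he => exact ⟨_, he.edge_mem⟩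

/-- Such an edge joins the two ends of the path; as vertices do not repeat, it is the whole path. -/
lemma eq_of_isLink (h : IsTPath G T P) (hl : P.IsLink e x y) (hx : x ∈ T) (hy : y ∈ T) :
    V(P) = {x, y} ∧ E(P) = {e} := by
  obtain ⟨-, a, b, hab, ⟨vs, es, htr, hV, hE⟩, hcap⟩ := h
  have he : e ∈ es := by have := hl.edge_mem; rwa [hE] at this
  have hxab : x = a ∨ x = b := (hcap ▸ ⟨hl.left_mem, hx⟩ : x ∈ ({a, b} : Set α))
  have hyab : y = a ∨ y = b := (hcap ▸ ⟨hl.right_mem, hy⟩ : y ∈ ({a, b} : Set α))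
  have hxy := (htr.edge_ends he hl).1
  have hcase : (x = a ∧ y = b) ∨ (x = b ∧ y = a) := by
    rcases hxab with rfl | rfl <;> rcases hyab with rfl | rfl <;> simp_all
  have hlab : P.IsLink e a b := by
    rcases hcase with ⟨rfl, rfl⟩ | ⟨rfl, rfl⟩
    · exact hl
    · exact hl.symm
  obtain ⟨rfl, rfl⟩ := htr.eq_single_of_isLink he hlab
  rw [hV, hE]
  constructor
  · ext v
    rcases hcase with ⟨rfl, rfl⟩ | ⟨rfl, rfl⟩ <;> simp [or_comm]
  · ext v; simp

/-- Distinct openly disjoint `T`-paths are edge-disjoint. -/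
lemma disjoint_edgeSet (hP : IsTPath G T P) (hQ : IsTPath G T Q) (hne : P ≠ Q)
    (hd : V(P) ∩ V(Q) ⊆ T) (heP : e ∈ E(P)) (heQ : e ∈ E(Q)) : False := by
  obtain ⟨x, y, hl⟩ := Graph.exists_isLink_of_mem_edgeSet heP
  have hlQ : Q.IsLink e x y := (hQ.1.isLink_iff heQ).2 (hl.mono hP.1)
  -- Both ends of a shared edge are shared vertices, hence terminals, so each path consists of this
  -- edge alone.
  have hx : x ∈ T := hd ⟨hl.left_mem, hlQ.left_mem⟩
  have hy : y ∈ T := hd ⟨hl.right_mem, hlQ.right_mem⟩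
  obtain ⟨h1, h2⟩ := hP.eq_of_isLink hl hx hy
  obtain ⟨h3, h4⟩ := hQ.eq_of_isLink hlQ hx hy
  exact hne (Graph.Compatible.ext (h1.trans h3.symm) (h2.trans h4.symm) (.of_le_le hP.1 hQ.1))

end IsTPath

lemma finite_setOf_le (hV : V(G).Finite) (hE : E(G).Finite) : {P | P ≤ G}.Finite := by
  refine Set.Finite.of_injOn (f := fun P : Graph α β => (V(P), E(P)))
    (t := V(G).powerset ×ˢ E(G).powerset) ?_ ?_ (hV.finite_subsets.prod hE.finite_subsets)
  · intro P hP
    exact ⟨hP.1, Graph.IsSubgraph.edgeSet_mono hP⟩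
  · intro P hP Q hQ h
    exact Graph.Compatible.ext (congrArg Prod.fst h) (congrArg Prod.snd h) (.of_le_le hP hQ)

/-! ### Translating packings of T-paths into packings of lists -/

section Encoding

variable {T : Finset α} {W : Type*} {A : W → W → Prop} {τ : T → W} {own : Graph α β → W → Prop}

lemma realizes_iff {F : Finset (Graph α β)} (hF : ∀ P ∈ F, IsTPath G T P)
    [∀ t : T, DecidablePred fun P : Graph α β => t.1 ∈ V(P)] {m : T → ℤ} :
    Realizes F m ↔ ∀ t : T, m t = (F.filter fun P => t.1 ∈ V(P)).card := by
  refine forall_congr' fun t => ?_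
  rw [← Set.ncard_coe_finset]
  have : ({P | P ∈ F ∧ ∃ s, IsPathBetween P t s} : Set (Graph α β)) =
      ↑(F.filter fun P => t.1 ∈ V(P)) := by
    ext P
    simp only [Finset.coe_filter]
    exact and_congr_right fun hP => (hF P hP).exists_isPathBetween_iff t.2
  rw [this]

/-- A correspondence between `T`-paths in `G` and paths for the relation `A` that respects ends and
the ownership of non-terminals translates packings into packings. -/
theorem setOf_realizes_eq (hT : ∀ x ∈ Set.range τ, ∀ y ∈ Set.range τ, ¬ A x y)
    (hA : ∀ x y, A x y → A y x)
    (hown : ∀ P, IsTPath G T P → ∃ x ∉ Set.range τ, own P x)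
    (htolist : ∀ P, IsTPath G T P → ∃ l, (∃ s t, IsTerminalPath A (Set.range τ) l s t) ∧
      (∀ x ∈ l, x ∉ Set.range τ → own P x) ∧ ∀ t : T, τ t ∈ l ↔ t.1 ∈ V(P))
    (hofList : ∀ l, (∃ s t, IsTerminalPath A (Set.range τ) l s t) → ∃ P, IsTPath G T P ∧
      (∀ x ∉ Set.range τ, own P x → x ∈ l) ∧ ∀ t : T, τ t ∈ l ↔ t.1 ∈ V(P)) :
    {m : T → ℤ | ∃ F : Finset (Graph α β), (∀ P ∈ F, IsTPath G T P) ∧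
      (∀ P ∈ F, ∀ Q ∈ F, P ≠ Q → ∀ x ∉ Set.range τ, own P x → ¬ own Q x) ∧ Realizes F m} =
    {m : T → ℤ | ∃ F, IsPacking A (Set.range τ) F ∧ ∀ t, m t = deg F (τ t)} := by
  classical
  ext m
  constructor
  · rintro ⟨F, hF, hdisj, hm⟩
    rw [realizes_iff hF] at hm
    choose! f hfp hfown hfT using htolist
    have hinj : ∀ P ∈ F, ∀ Q ∈ F, ∀ x ∉ Set.range τ, x ∈ f P → x ∈ f Q → P = Q := by
      intro P hP Q hQ x hx hxP hxQ
      by_contra hne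
      exact hdisj P hP Q hQ hne x hx (hfown P (hF P hP) x hxP hx) (hfown Q (hF Q hQ) x hxQ hx)
    -- Every terminal path has a non-terminal, the neighbour of its first vertex. Its T-path owns
    -- it, so two disjoint T-paths cannot have the same list.
    have hinjOn : Set.InjOn f F := by
      intro P hP Q hQ h
      obtain ⟨s, t, hst⟩ := hfp P (hF P hP)
      obtain ⟨y, hy⟩ := hst.exists_link
      have hs : s ∈ Set.range τ := by obtain ⟨mid, -, h, -⟩ := hst; exact h
      exact hinj P hP Q hQ y (fun h => hT s hs y h (hst.adj_of_link hA hy)) hy.right_mem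
        (h ▸ hy.right_mem)
    refine ⟨F.image f, ⟨?_, ?_⟩, fun t => ?_⟩
    · intro l hl
      obtain ⟨P, hP, rfl⟩ := Finset.mem_image.1 hl
      exact hfp P (hF P hP)
    · intro l hl l' hl' x hx hxl hxl'
      obtain ⟨P, hP, rfl⟩ := Finset.mem_image.1 hl
      obtain ⟨Q, hQ, rfl⟩ := Finset.mem_image.1 hl'
      rw [hinj P hP Q hQ x hx hxl hxl']
    · rw [hm, deg, Finset.sum_image hinjOn, Finset.sum_boole]
      congr 2
      exact Finset.filter_congr fun P hP => (hfT P (hF P hP) t).symm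
  · rintro ⟨F, hF, hm⟩
    choose! g hgp hgown hgT using hofList
    have hinj : ∀ l ∈ F, ∀ l' ∈ F, ∀ x ∉ Set.range τ, own (g l) x → own (g l') x → l = l' :=
      fun l hl l' hl' x hx h h' => hF.2 l hl l' hl' x hx (hgown l (hF.1 l hl) x hx h)
        (hgown l' (hF.1 l' hl') x hx h')
    have hinjOn : Set.InjOn g F := by
      intro l hl l' hl' h
      obtain ⟨x, hx, hxo⟩ := hown _ (hgp l (hF.1 l hl))
      exact hinj l hl l' hl' x hx hxo (h ▸ hxo)
    have hTP : ∀ P ∈ F.image g, IsTPath G T P := by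
      intro P hP
      obtain ⟨l, hl, rfl⟩ := Finset.mem_image.1 hP
      exact hgp l (hF.1 l hl)
    refine ⟨F.image g, hTP, ?_, (realizes_iff hTP).2 fun t => ?_⟩
    · intro P hP Q hQ hne x hx hxP hxQ
      obtain ⟨l, hl, rfl⟩ := Finset.mem_image.1 hP
      obtain ⟨l', hl', rfl⟩ := Finset.mem_image.1 hQ
      exact hne (by rw [hinj l hl l' hl' x hx hxP hxQ])
    · rw [hm, deg, ← Finset.sum_boole, Finset.sum_image hinjOn]
      exact Finset.sum_congr rfl fun l hl => by simp only [hgT l (hF.1 l hl) t]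

end Encoding

/-! ### Openly disjoint paths: subdividing the edges -/

section Subdivision

/-- Adjacency in the graph obtained from `G` by subdividing every edge. -/
def SubdivAdj (G : Graph α β) : α ⊕ β → α ⊕ β → Prop
  | .inl v, .inr e => G.Inc e v
  | .inr e, .inl v => G.Inc e v
  | _, _ => False

lemma SubdivAdj.symm : ∀ x y : α ⊕ β, SubdivAdj G x y → SubdivAdj G y x := by
  rintro (_ | _) (_ | _) h <;> exact h

lemma Traverses.exists_subdivision (h : Traverses G s t vs es) :
    ∃ L : List (α ⊕ β), L.head? = some (.inl s) ∧ L.getLast? = some (.inl t) ∧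
      L.IsChain (SubdivAdj G) ∧ L.Nodup ∧ (∀ v, .inl v ∈ L ↔ v ∈ vs) ∧
      ∀ e, .inr e ∈ L ↔ e ∈ es := by
  induction h with
  | @nil x hx => exact ⟨[.inl x], by simp⟩
  | @cons x y z e vs es he hp hx ih =>
    obtain ⟨L, h1, h2, h3, h4, h5, h6⟩ := ih
    obtain ⟨L, rfl⟩ : ∃ L', L = .inl y :: L' := by
      cases L with
      | nil => simp at h1
      | cons a L => exact ⟨L, by simpa using h1⟩
    refine ⟨.inl x :: .inr e :: .inl y :: L, by simp, by simpa using h2, ?_, ?_, ?_, ?_⟩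
    · exact List.isChain_cons_cons.2 ⟨he.inc_left, List.isChain_cons_cons.2 ⟨he.inc_right, h3⟩⟩
    · have hxL : .inl x ∉ (.inl y :: L : List (α ⊕ β)) := by rwa [h5]
      have heL : .inr e ∉ (.inl y :: L : List (α ⊕ β)) := by
        rw [h6]; exact fun h => hx (hp.edge_ends h he).2.1
      rw [List.nodup_cons, List.nodup_cons]
      exact ⟨by rw [List.mem_cons]; simpa using hxL, heL, h4⟩
    · intro v
      rw [List.mem_cons, List.mem_cons, h5]; simp
    · intro f
      rw [List.mem_cons, List.mem_cons, h6]; simp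

lemma exists_traverses_of_subdivision : ∀ (L : List (α ⊕ β)) (s : α), s ∈ V(G) →
    (.inl s :: L).IsChain (SubdivAdj G) → (.inl s :: L).Nodup →
    (.inl s :: L : List (α ⊕ β)).getLast? = some (.inl t) →
    ∃ vs es, Traverses G s t vs es ∧ (∀ v, .inl v ∈ (.inl s :: L : List (α ⊕ β)) ↔ v ∈ vs) ∧
      ∀ e, .inr e ∈ (.inl s :: L : List (α ⊕ β)) ↔ e ∈ es
  | [], s, hs, _, _, hl => by
    obtain rfl : s = t := by simpa using hl
    exact ⟨_, _, .nil hs, by simp⟩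
  | [.inr e], s, _, _, _, hl => by simp at hl
  | .inl v :: L, s, _, hc, _, _ => (List.isChain_cons_cons.1 hc).1.elim
  | .inr e :: .inr f :: L, s, _, hc, _, _ =>
    (List.isChain_cons_cons.1 (List.isChain_cons_cons.1 hc).2).1.elim
  | .inr e :: .inl y :: L, s, _, hc, hnd, hl => by
    obtain ⟨h1, hc⟩ := List.isChain_cons_cons.1 hc
    obtain ⟨h2, hc⟩ := List.isChain_cons_cons.1 hc
    obtain ⟨hs, hnd⟩ := List.nodup_cons.1 hnd
    obtain ⟨-, hnd⟩ := List.nodup_cons.1 hnd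
    change G.Inc e s at h1
    change G.Inc e y at h2
    obtain ⟨vs, es, htr, hv, he⟩ := exists_traverses_of_subdivision L y h2.vertex_mem hc hnd
      (by simpa using hl)
    obtain ⟨z, hz⟩ := h1
    -- Incidence alone would allow `e` to be a loop at `s`; since vertices do not repeat, `e` joins
    -- `s` to `y`.
    have hsy : s ≠ y := by rintro rfl; simp at hs
    obtain rfl := h2.eq_of_isLink_of_ne_left hz hsy.symm
    refine ⟨_, _, .cons hz htr ?_, ?_, ?_⟩
    · rw [← hv]; exact fun h => hs (List.mem_cons_of_mem _ h)
    · intro v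
      rw [List.mem_cons, List.mem_cons, hv]; simp
    · intro f
      rw [List.mem_cons, List.mem_cons, he]; simp

variable {T : Finset α}

/-- The vertices and edges of a graph, as vertices of its subdivision. -/
def Owns (P : Graph α β) : α ⊕ β → Prop
  | .inl v => v ∈ V(P)
  | .inr e => e ∈ E(P)

lemma IsTPath.exists_subdivision (h : IsTPath G T P) :
    ∃ l, (∃ s t, IsTerminalPath (SubdivAdj G) (Set.range fun t : T => .inl t.1) l s t) ∧
      (∀ x ∈ l, x ∉ Set.range (fun t : T => .inl t.1) → Owns P x) ∧
      ∀ t : T, .inl t.1 ∈ l ↔ t.1 ∈ V(P) := by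
  obtain ⟨hPG, a, b, hab, ⟨vs, es, htr, hV, hE⟩, hcap⟩ := h
  obtain ⟨L, h1, h2, h3, h4, h5, h6⟩ := (htr.mono hPG).exists_subdivision
  have haT : a ∈ T := (hcap.symm ▸ (by simp) : a ∈ V(P) ∩ (T : Set α)).2
  have hbT : b ∈ T := (hcap.symm ▸ (by simp) : b ∈ V(P) ∩ (T : Set α)).2
  obtain ⟨mid, rfl⟩ : ∃ mid, L = .inl a :: (mid ++ [.inl b]) := by
    rw [List.getLast?_eq_some_iff] at h2
    obtain ⟨M, rfl⟩ := h2
    cases M with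
    | nil => simp at h1; exact absurd h1.symm hab
    | cons c M => exact ⟨M, by simpa using h1⟩
  refine ⟨_, ⟨.inl a, .inl b, mid, rfl, ⟨⟨a, haT⟩, rfl⟩, ⟨⟨b, hbT⟩, rfl⟩, by simpa using hab, ?_, ?_,
    h3⟩, ?_, ?_⟩
  · rintro _ hx ⟨⟨v, hvT⟩, rfl⟩
    have hv : v ∈ V(P) := by rw [hV]; exact (h5 v).1 (by simp [hx])
    have : v = a ∨ v = b := (hcap ▸ ⟨hv, hvT⟩ : v ∈ ({a, b} : Set α))
    rw [List.nodup_cons, List.nodup_append] at h4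
    rcases this with rfl | rfl
    · exact h4.1 (by simp [hx])
    · exact h4.2.2.2 _ hx _ (by simp) rfl
  · exact (List.nodup_append.1 (List.nodup_cons.1 h4).2).1
  · rintro (v | e) hx -
    · change v ∈ V(P); rw [hV]; exact (h5 v).1 hx
    · change e ∈ E(P); rw [hE]; exact (h6 e).1 hx
  · intro t
    rw [h5, hV]; rfl

lemma exists_isTPath_of_subdivision (hT : (T : Set α) ⊆ V(G)) {l : List (α ⊕ β)}
    (h : ∃ s t, IsTerminalPath (SubdivAdj G) (Set.range fun t : T => .inl t.1) l s t) :
    ∃ P, IsTPath G T P ∧ (∀ x ∉ Set.range (fun t : T => .inl t.1), Owns P x → x ∈ l) ∧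
      ∀ t : T, .inl t.1 ∈ l ↔ t.1 ∈ V(P) := by
  obtain ⟨s, t, h⟩ := h
  have hnd := h.nodup
  have hmem := fun w hw => h.mem_iff (w := w) hw
  obtain ⟨mid, rfl, ⟨⟨a, ha⟩, rfl⟩, ⟨⟨b, hb⟩, rfl⟩, hab, hmid, -, hc⟩ := h
  obtain ⟨vs, es, htr, hv, he⟩ := exists_traverses_of_subdivision (t := b) _ a (hT ha) hc hnd
    (by rw [← List.cons_append, List.getLast?_concat])
  obtain ⟨P, hPG, htrP, hV, hE⟩ := htr.exists_subgraph
  have hVT : ∀ t : T, .inl t.1 ∈ (.inl a :: (mid ++ [.inl b]) : List (α ⊕ β)) ↔ t.1 ∈ V(P) := by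
    intro t; rw [hv, hV]; rfl
  refine ⟨P, ⟨hPG, a, b, by simpa using hab, ⟨vs, es, htrP, hV, hE⟩, ?_⟩, ?_, hVT⟩
  · ext v
    constructor
    · rintro ⟨h1, h2⟩
      have := (hmem (.inl v) ⟨⟨v, h2⟩, rfl⟩).1 ((hVT ⟨v, h2⟩).2 h1)
      simpa using this
    · rintro (rfl | rfl)
      · exact ⟨(hVT ⟨v, ha⟩).1 (by simp), ha⟩
      · exact ⟨(hVT ⟨v, hb⟩).1 (by simp), hb⟩
  · rintro (v | e) - hx
    · change v ∈ V(P) at hx; rw [hV] at hx; exact (hv v).2 hx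
    · change e ∈ E(P) at hx; rw [hE] at hx; exact (he e).2 hx

theorem isParityJumpSystem_jVertex [DecidableEq α] (hT : (T : Set α) ⊆ V(G)) :
    IsParityJumpSystem (JVertex G T) := by
  have hindep : ∀ x ∈ Set.range (fun t : T => (.inl t.1 : α ⊕ β)),
      ∀ y ∈ Set.range (fun t : T => (.inl t.1 : α ⊕ β)), ¬ SubdivAdj G x y := by
    rintro _ ⟨t, rfl⟩ _ ⟨t', rfl⟩ h; exact h
  have heq : JVertex G T = _ :=
    Eq.trans ?_ (setOf_realizes_eq (G := G) (own := Owns) hindep SubdivAdj.symm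
    (fun P hP => by
      obtain ⟨e, he⟩ := hP.edgeSet_nonempty
      exact ⟨.inr e, by simp, he⟩)
    (fun P hP => hP.exists_subdivision) fun l hl => exists_isTPath_of_subdivision hT hl)
  · rw [heq]
    refine isParityJumpSystem_deg SubdivAdj.symm hindep _ ?_ rfl
    intro t t' h
    exact Subtype.ext (Sum.inl_injective h)
  -- The subdividing points are non-terminals, so the encoding demands edge-disjointness too; for
  -- distinct T-paths `IsTPath.disjoint_edgeSet` provides it.
  · ext m
    refine exists_congr fun F => and_congr_right fun hF => and_congr_left fun _ => ?_
    refine forall₂_congr fun P hP => forall₂_congr fun Q hQ => forall_congr' fun hne => ?_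
    constructor
    · rintro hd (v | e) hx h h'
      · exact hx ⟨⟨v, hd ⟨h, h'⟩⟩, rfl⟩
      · exact (hF P hP).disjoint_edgeSet (hF Q hQ) hne hd h h'
    · rintro hd v ⟨h, h'⟩
      by_contra hv
      refine hd (.inl v) ?_ h h'
      rintro ⟨⟨t, ht⟩, htv⟩
      exact hv (Sum.inl_injective htv ▸ ht)

end Subdivision

/-! ### Edge-disjoint paths: the line graph with terminals -/

section LineGraph

variable {T : Finset α}

/-- Adjacency of edges that share a vertex outside `T`, and of vertices in `T` and their edges. -/
def LineAdj (G : Graph α β) (T : Finset α) : T ⊕ β → T ⊕ β → Prop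
  | .inl v, .inr e => G.Inc e v
  | .inr e, .inl v => G.Inc e v
  | .inr e, .inr f => ∃ v ∉ T, G.Inc e v ∧ G.Inc f v
  | .inl _, .inl _ => False

lemma LineAdj.symm : ∀ x y : T ⊕ β, LineAdj G T x y → LineAdj G T y x := by
  rintro (_ | _) (_ | _) h
  · exact h
  · exact h
  · exact h
  · obtain ⟨v, hv, h1, h2⟩ := h
    exact ⟨v, hv, h2, h1⟩

/-- Consecutive edges meet in an inner vertex, which lies outside T. The edge `e` is the one by
which `s` was reached. -/
lemma Traverses.isChain_lineAdj {t : T} (h : Traverses G s t vs es)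
    (hvs : ∀ v ∈ vs, v ∈ T → v = t) (e : β) (he : G.Inc e s) :
    (.inr e :: (es.map .inr ++ [.inl t])).IsChain (LineAdj G T) := by
  generalize ht : t.1 = t' at h
  induction h generalizing e with
  | nil =>
    subst ht
    exact List.isChain_cons_cons.2 ⟨he, List.isChain_singleton _⟩
  | @cons x y z f vs es hf hp hx ih =>
    subst ht
    have hxT : x ∉ T := fun h => hx (hvs x (by simp) h ▸ hp.right_mem)
    refine List.isChain_cons_cons.2 ⟨⟨x, hxT, he, hf.inc_left⟩, ?_⟩
    exact ih (fun v hv => hvs v (by simp [hv])) f hf.inc_right rfl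

/-- Edges may be distinct while the walk they form in G revisits vertices or contains loops. If the
entry vertex `x` already lies on the traversal built for the rest, that traversal is cut to begin at
`x`. Edges are only dropped, so disjointness survives, and inner vertices stay outside T because
adjacent edges share a non-terminal. -/
lemma exists_traverses_of_isChain_lineAdj {t : T} (es : List β) : ∀ (e : β) (x : α), G.Inc e x →
    (.inr e :: (es.map .inr ++ [.inl t])).IsChain (LineAdj G T) →
    ∃ vs es', Traverses G x t vs es' ∧ es' ⊆ e :: es ∧ ∀ v ∈ vs, v ∈ T → v = x ∨ v = t := by
  induction es with
  | nil =>
    intro e x hx hc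
    have het : G.Inc e t := (List.isChain_cons_cons.1 hc).1
    by_cases hxt : x = t
    · subst hxt
      exact ⟨_, _, .nil hx.vertex_mem, by simp, by simp⟩
    · obtain ⟨y, hy⟩ := hx
      obtain h := het.eq_of_isLink_of_ne_left hy (Ne.symm hxt)
      refine ⟨_, _, .cons (h ▸ hy) (.nil het.vertex_mem) (by simpa using hxt), by simp, ?_⟩
      simp
  | cons f es ih =>
    intro e x hx hc
    obtain ⟨⟨v, hvT, hev, hfv⟩, hc⟩ := List.isChain_cons_cons.1 hc
    obtain ⟨vs, es', htr, hsub, hT⟩ := ih f v hfv hc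
    have hT' : ∀ u ∈ vs, u ∈ T → u = t := fun u hu huT =>
      (hT u hu huT).resolve_left fun h => hvT (h ▸ huT)
    by_cases hxvs : x ∈ vs
    · obtain ⟨vs', es'', htr', h1, h2⟩ := htr.suffix hxvs
      exact ⟨vs', es'', htr', fun a ha => List.mem_cons_of_mem _ (hsub (h2 ha)),
        fun u hu huT => Or.inr (hT' u (h1 hu) huT)⟩
    · have hxv : v ≠ x := fun h => hxvs (h ▸ htr.left_mem)
      obtain ⟨y, hy⟩ := hx
      obtain rfl := hev.eq_of_isLink_of_ne_left hy hxv
      refine ⟨_, _, .cons hy htr hxvs, ?_, ?_⟩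
      · exact List.cons_subset_cons _ hsub
      · intro u hu huT
        exact (List.mem_cons.1 hu).imp id fun hu => hT' u hu huT

/-- The edges of a graph, as vertices of a line graph with terminals. -/
def OwnsEdge (P : Graph α β) : T ⊕ β → Prop
  | .inl _ => False
  | .inr e => e ∈ E(P)

lemma IsTPath.exists_lineGraph (h : IsTPath G T P) :
    ∃ l, (∃ s t, IsTerminalPath (LineAdj G T) (Set.range Sum.inl) l s t) ∧
      (∀ x ∈ l, x ∉ Set.range Sum.inl → OwnsEdge P x) ∧
      ∀ t : T, .inl t ∈ l ↔ t.1 ∈ V(P) := by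
  obtain ⟨hPG, a, b, hab, ⟨vs, es, htr, hV, hE⟩, hcap⟩ := h
  have haT : a ∈ T := (hcap.symm ▸ (by simp) : a ∈ V(P) ∩ (T : Set α)).2
  have hbT : b ∈ T := (hcap.symm ▸ (by simp) : b ∈ V(P) ∩ (T : Set α)).2
  have hchain : (.inl ⟨a, haT⟩ :: (es.map .inr ++ [.inl ⟨b, hbT⟩])).IsChain (LineAdj G T) := by
    cases htr with
    | nil => exact absurd rfl hab
    | cons he hp hx =>
      refine List.isChain_cons_cons.2 ⟨(he.mono hPG).inc_left, ?_⟩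
      refine (hp.mono hPG).isChain_lineAdj (t := ⟨b, hbT⟩) (fun v hv hvT => ?_) _
        (he.mono hPG).inc_right
      have hvP : v ∈ V(P) := hp.vertex_mem hv
      have : v = a ∨ v = b := (hcap ▸ ⟨hvP, hvT⟩ : v ∈ ({a, b} : Set α))
      exact this.resolve_left fun h => hx (h ▸ hv)
  refine ⟨_, ⟨_, _, es.map .inr, rfl, ⟨_, rfl⟩, ⟨_, rfl⟩, by simpa using hab, by simp,
    htr.edges_nodup.map Sum.inr_injective, hchain⟩, ?_, ?_⟩
  · rintro (v | e) hx hxT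
    · exact hxT ⟨v, rfl⟩
    · change e ∈ E(P)
      rw [hE]
      simpa using hx
  · intro t
    have : t.1 ∈ V(P) ↔ t.1 ∈ ({a, b} : Set α) := by
      rw [← hcap]; exact ⟨fun h => ⟨h, t.2⟩, fun h => h.1⟩
    rw [this]
    simp [Subtype.ext_iff]

lemma exists_isTPath_of_lineGraph {l : List (T ⊕ β)}
    (h : ∃ s t, IsTerminalPath (LineAdj G T) (Set.range Sum.inl) l s t) :
    ∃ P, IsTPath G T P ∧ (∀ x ∉ Set.range Sum.inl, OwnsEdge P x → x ∈ l) ∧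
      ∀ t : T, .inl t ∈ l ↔ t.1 ∈ V(P) := by
  obtain ⟨s, t, h⟩ := h
  have hmem := fun w hw => h.mem_iff (w := w) hw
  obtain ⟨mid, rfl, ⟨a, rfl⟩, ⟨b, rfl⟩, hab, hmid, -, hc⟩ := h
  obtain ⟨es, rfl⟩ : ∃ es : List β, es.map Sum.inr = mid := by
    change mid ∈ Set.range (List.map Sum.inr)
    rw [Set.range_list_map]
    rintro (v | e) hx
    · exact absurd ⟨v, rfl⟩ (hmid _ hx)
    · exact ⟨e, rfl⟩
  cases es with
  | nil => exact (List.isChain_cons_cons.1 hc).1.elim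
  | cons e es =>
  obtain ⟨hea, hc⟩ := List.isChain_cons_cons.1 hc
  obtain ⟨vs, es', htr, hsub, hT⟩ := exists_traverses_of_isChain_lineAdj (G := G) es e a hea hc
  obtain ⟨P, hPG, htrP, hV, hE⟩ := htr.exists_subgraph
  have hab' : a.1 ≠ b.1 := fun h => hab (by rw [Subtype.ext h])
  have hcap : V(P) ∩ (T : Set α) = {a.1, b.1} := by
    ext v
    rw [hV]
    constructor
    · rintro ⟨h1, h2⟩
      exact hT v h1 h2
    · rintro (rfl | rfl)
      · exact ⟨htr.left_mem, a.2⟩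
      · exact ⟨htr.right_mem, b.2⟩
  refine ⟨P, ⟨hPG, a, b, hab', ⟨vs, es', htrP, hV, hE⟩, hcap⟩, ?_, ?_⟩
  · rintro (v | f) - hx
    · exact hx.elim
    · change f ∈ E(P) at hx
      rw [hE] at hx
      have := hsub hx
      simpa using this
  · intro t
    have : t.1 ∈ V(P) ↔ t.1 ∈ ({a.1, b.1} : Set α) := by
      rw [← hcap]; exact ⟨fun h => ⟨h, t.2⟩, fun h => h.1⟩
    rw [this, hmem _ ⟨t, rfl⟩, Sum.inl_injective.eq_iff, Sum.inl_injective.eq_iff, Subtype.ext_iff,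
      Subtype.ext_iff]
    rfl

theorem isParityJumpSystem_jEdge [DecidableEq α] : IsParityJumpSystem (JEdge G T) := by
  have hindep : ∀ x ∈ Set.range (Sum.inl : T → T ⊕ β),
      ∀ y ∈ Set.range (Sum.inl : T → T ⊕ β), ¬ LineAdj G T x y := by
    rintro _ ⟨t, rfl⟩ _ ⟨t', rfl⟩ h; exact h
  have heq : JEdge G T = _ :=
    Eq.trans ?_ (setOf_realizes_eq (G := G) (own := OwnsEdge) hindep LineAdj.symm
    (fun P hP => by
      obtain ⟨e, he⟩ := hP.edgeSet_nonempty
      exact ⟨.inr e, by simp, he⟩)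
    (fun P hP => hP.exists_lineGraph) fun l hl => exists_isTPath_of_lineGraph hl)
  · rw [heq]
    exact isParityJumpSystem_deg LineAdj.symm hindep _ Sum.inl_injective rfl
  · ext m
    refine exists_congr fun F => and_congr_right fun _ => and_congr_left fun _ => ?_
    refine forall₂_congr fun P hP => forall₂_congr fun Q hQ => forall_congr' fun _ => ?_
    rw [Set.eq_empty_iff_forall_notMem]
    constructor
    · rintro hd (v | e) hx h h'
      · exact h
      · exact hd e ⟨h, h'⟩
    · rintro hd e ⟨h, h'⟩
      exact hd (.inr e) (by simp) h h'

end LineGraph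

/-! ### Finiteness, and the theorem -/

lemma finite_setOf_realizes {T : Finset α} (hV : V(G).Finite) (hE : E(G).Finite)
    {J : Set (T → ℤ)}
    (hJ : ∀ m ∈ J, ∃ F : Finset (Graph α β), (∀ P ∈ F, IsTPath G T P) ∧ Realizes F m) :
    J.Finite := by
  have hfin : {F : Finset (Graph α β) | ∀ P ∈ F, P ≤ G}.Finite := by
    refine (finite_setOf_le hV hE).toFinset.powerset.finite_toSet.subset fun F hF => ?_
    refine Finset.mem_powerset.2 fun P hP => ?_
    rw [Set.Finite.mem_toFinset]
    exact hF P hP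
  refine (hfin.image fun F (t : T) =>
    (({P | P ∈ F ∧ ∃ s : α, IsPathBetween P t s} : Set (Graph α β)).ncard : ℤ)).subset ?_
  intro m hm
  obtain ⟨F, hF, hFm⟩ := hJ m hm
  exact ⟨F, fun P hP => (hF P hP).1, funext fun t => (hFm t).symm⟩

lemma Realizes.nonneg {T : Finset α} {F : Finset (Graph α β)} {m : T → ℤ} (h : Realizes F m)
    (t : T) : 0 ≤ m t := by
  rw [h t]; exact Int.natCast_nonneg _

lemma realizes_empty {T : Finset α} : Realizes (∅ : Finset (Graph α β)) (0 : T → ℤ) := by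
  intro t; simp

end TPaths

theorem corollary1 {α β : Type*} [DecidableEq α] (G : Graph α β)
    (hV : V(G).Finite) (hE : E(G).Finite) (T : Finset α) (hT : (T : Set α) ⊆ V(G)) :
    TPaths.IsBisubmodularPolyhedron (TPaths.conv (TPaths.JVertex G T)) ∧
      TPaths.IsBisubmodularPolyhedron (TPaths.conv (TPaths.JEdge G T)) := by
  constructor
  · refine (TPaths.isParityJumpSystem_jVertex hT).isBisubmodularPolyhedron
      (TPaths.finite_setOf_realizes hV hE ?_) ⟨∅, by simp, by simp, TPaths.realizes_empty⟩ ?_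
    · rintro m ⟨F, hF, -, h⟩; exact ⟨F, hF, h⟩
    · rintro m ⟨F, -, -, h⟩; exact h.nonneg
  · refine TPaths.isParityJumpSystem_jEdge.isBisubmodularPolyhedron
      (TPaths.finite_setOf_realizes hV hE ?_) ⟨∅, by simp, by simp, TPaths.realizes_empty⟩ ?_
    · rintro m ⟨F, hF, -, h⟩; exact ⟨F, hF, h⟩
    · rintro m ⟨F, -, -, h⟩; exact h.nonneg
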